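/- Fix $d\in\mathbb{N}$. A partition is $\lambda=(\lambda_1\ge\dots\ge\lambda_d)\in\mathbb{N}^d$. Let $x_1,\dots,x_d$ and $y_i$ $(i\in\mathbb{Z})$ be variables, and write $a'=d+1-a$. For partitions $\kappa\subseteq\mu$ (i.e. $\kappa_i\le\mu_i$ for all $i$), the reverse skew diagram $\mu/\kappa$ is the set of boxes $(r,c)$ with $1\le r\le d$ and $\kappa_r<c\le\mu_r$, where rows are numbered from bottom to top and columns from right to left; $\mu$ stands for $\mu/\emptyset$. A reverse tableau of shape $\mu/\kappa$ is a filling of the boxes with elements of $\{1,\dots,d\}$ that weakly increases along rows from left to right and strictly increases down columns. A reverse barred tableau of shape $\mu/\kappa$ is a reverse tableau in which each entry may in addition be barred or not; $\mathcal{B}(\mu/\kappa)$ is the set of these. For an entry $a$, let $|a|$ be its value without the bar and $r(a),c(a)$ its row and column numbers. Put $$s_{\mu/\kappa}(x\,|\,y)=\sum_{R}\ \prod_{a\in R}\bigl(x_a-y_{a'+c(a)-r(a)}\bigr),\qquad s_\mu(x\,|\,y)=s_{\mu/\emptyset}(x\,|\,y),$$ the sum being over the reverse tableaux $R$ of shape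 $\mu/\kappa$. (If $\kappa=\emptyset$, only $y_i$ with $i>0$ occur.) For a partition $\lambda$ and $B\in\mathcal{B}(\mu/\kappa)$, let $\lambda*B$ be obtained by placing the Young tableau whose $i$-th row consists of $\lambda_i$ unbarred $i$'s above and to the right of $B$. The unbarred column word $(\lambda*B)^u$ lists the unbarred entries, reading the columns from right to left and each column from top to bottom; $B^u$ is the corresponding word of $B$, and $(\lambda*B)^u_{<a}$ is the part of $(\lambda*B)^u$ written before the entry $a$ is reached. The content $\omega(w)\in\mathbb{N}^d$ of a word $w$ has as $k$-th coordinate the number of $k$'s in $w$. The word $w$ is Yamanouchi if each of its initial segments contains at least as many $i$'s as $(i+1)$'s, for $i=1,\dots,d-1$. Put $$c_{\lambda*B}=\prod_{a\in B\ \text{barred}}\bigl(y_{|a|'+\omega((\lambda*B)^u_{<a})_{|a|}}-y_{|a|'+c(a)-r(a)}\bigr).$$ **Corollary.** For all partitions $\lambda,\mu\in\mathbb{N}^d$, in $\mathbb{C}[y_i][x_1,\dots,x_d]$, $$s_\lambda(x\,|\,y)\,s_\mu(x\,|\,y)=\sum_{B} c_{\lambda*B}\; s_{\lambda+\omega(B^u)}(x\,|\,y),$$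 the sum being over all $B\in\mathcal{B}(\mu)$ such that $(\lambda*B)^u$ is Yamanouchi. More generally, for every partition $\kappa\subseteq\mu$, $$s_\lambda(x\,|\,y)\,s_{\mu/\kappa}(x\,|\,y)=\sum_{B} c_{\lambda*B}\; s_{\lambda+\omega(B^u)}(x\,|\,y),$$ the sum being over all $B\in\mathcal{B}(\mu/\kappa)$ such that $(\lambda*B)^u$ is Yamanouchi. -/

import Mathlib

namespace FactorialLR

/-!
Conventions. Elements of `ℕ^d` are functions `Fin d → ℕ`; partitions with at most `d` parts are the
antitone ones. The letters `1, …, d`, the row numbers and the column numbers are shifted by one: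
`k : Fin d` stands for the letter (or the row number) `k + 1`, and `c : ℕ` for the column
number `c + 1`. So, for a letter `a` represented by `k`, the number `a' = d + 1 - a` is `d - k`,
and the difference `c - r` of a column number and a row number is unaffected by the shift.
-/

/-- The boxes `(r, c)` of the reverse skew diagram `μ/κ`. Rows are numbered from bottom to top and
columns from right to left; row `r` of `μ` occupies the first `μ r` columns, and the first `κ r` of
these boxes are removed. -/
def boxes {d : ℕ} (μ κ : Fin d → ℕ) : Finset (Fin d × ℕ) :=
  (Finset.univ ×ˢ Finset.range (Finset.univ.sup μ)).filter fun b => κ b.1 ≤ b.2 ∧ b.2 < μ b.1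

/-- The type of boxes of `μ/κ`. -/
abbrev Box {d : ℕ} (μ κ : Fin d → ℕ) : Type := {b : Fin d × ℕ // b ∈ boxes μ κ}

/-- The row of a box (numbered from bottom to top). -/
abbrev Box.row {d : ℕ} {μ κ : Fin d → ℕ} (b : Box μ κ) : Fin d := b.1.1

/-- The column of a box (numbered from right to left). -/
abbrev Box.col {d : ℕ} {μ κ : Fin d → ℕ} (b : Box μ κ) : ℕ := b.1.2

/-- The entries weakly increase along rows from left to right (that is, as the column number
decreases) and strictly increase down columns (that is, as the row number decreases). -/
def IsSemistandard {d : ℕ} {μ κ : Fin d → ℕ} (T : Box μ κ → Fin d) : Prop :=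
  (∀ p q : Box μ κ, p.row = q.row → p.col < q.col → T q ≤ T p) ∧
  (∀ p q : Box μ κ, p.col = q.col → p.row < q.row → T q < T p)

instance {d : ℕ} {μ κ : Fin d → ℕ} (T : Box μ κ → Fin d) : Decidable (IsSemistandard T) :=
  inferInstanceAs (Decidable (_ ∧ _))

/-- The reverse tableaux of shape `μ/κ`, with entries in `{1, …, d}`. -/
def reverseTableaux {d : ℕ} (μ κ : Fin d → ℕ) : Finset (Box μ κ → Fin d) :=
  Finset.univ.filter IsSemistandard

/-- The reverse barred tableaux of shape `μ/κ`. The entry `(k, false)` is the unbarred letter `k`,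
and `(k, true)` is the barred letter; bars are ignored in the conditions on rows and columns. -/
def reverseBarredTableaux {d : ℕ} (μ κ : Fin d → ℕ) : Finset (Box μ κ → Fin d × Bool) :=
  Finset.univ.filter fun B => IsSemistandard fun b => (B b).1

/-- The boxes of `μ/κ` in reading order: columns from right to left, each from top to bottom. -/
def readingOrder {d : ℕ} (μ κ : Fin d → ℕ) : List (Box μ κ) :=
  (List.range (Finset.univ.sup μ)).flatMap fun c =>
    (List.finRange d).reverse.filterMap fun r =>
      if h : (r, c) ∈ boxes μ κ then some ⟨(r, c), h⟩ else none

/-- The word of the unbarred entries of `B` in a list of boxes; barred entries are skipped. -/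
def unbarredEntries {d : ℕ} {μ κ : Fin d → ℕ} (B : Box μ κ → Fin d × Bool)
    (l : List (Box μ κ)) : List (Fin d) :=
  l.filterMap fun b => if (B b).2 then none else some (B b).1

/-- The unbarred column word `B^u`. -/
def unbarredWord {d : ℕ} {μ κ : Fin d → ℕ} (B : Box μ κ → Fin d × Bool) : List (Fin d) :=
  unbarredEntries B (readingOrder μ κ)

/-- The content `ω(w)` of a word: the `k`-th coordinate is the number of letters `k`. -/
def content {d : ℕ} (w : List (Fin d)) : Fin d → ℕ := fun k => w.count k

/-- The column word of the Young tableau of shape `lam` whose `i`-th row consists of `lam i`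
letters `i`: columns from right to left (column `c` of a Young diagram is here the `c`-th from
the left), each from top to bottom. -/
def youngWord {d : ℕ} (lam : Fin d → ℕ) : List (Fin d) :=
  (List.range (Finset.univ.sup lam)).reverse.flatMap fun c =>
    (List.finRange d).filter fun r => c < lam r

/-- The unbarred column word `(λ * B)^u` of the skew barred tableau `λ * B`, in which the Young
tableau whose `i`-th row consists of `λ_i` letters `i` is placed above and to the right of `B`. -/
def starWord {d : ℕ} (lam : Fin d → ℕ) {μ κ : Fin d → ℕ} (B : Box μ κ → Fin d × Bool) :
    List (Fin d) :=
  youngWord lam ++ unbarredWord B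

/-- The part `(λ * B)^u_{<a}` of the unbarred column word of `λ * B` that is written before
reaching the box `a` of `B`. -/
def starWordBefore {d : ℕ} (lam : Fin d → ℕ) {μ κ : Fin d → ℕ} (B : Box μ κ → Fin d × Bool)
    (a : Box μ κ) : List (Fin d) :=
  youngWord lam ++ unbarredEntries B ((readingOrder μ κ).takeWhile fun b => b ≠ a)

/-- A word is Yamanouchi if each initial segment contains at least as many `i`'s
as `(i+1)`'s, for all `i`. -/
def IsYamanouchi {d : ℕ} (w : List (Fin d)) : Prop :=
  ∀ u ∈ w.inits, ∀ i j : Fin d, (j : ℕ) = i + 1 → u.count j ≤ u.count i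

instance {d : ℕ} (w : List (Fin d)) : Decidable (IsYamanouchi w) :=
  inferInstanceAs (Decidable (∀ u ∈ w.inits, _))

/-- The ring `ℂ[y_i]`. For straight shapes only the variables `y_i` with `i > 0` occur in the
polynomials below; for skew shapes non-positive indices can occur too. -/
abbrev YRing : Type := MvPolynomial ℤ ℂ

/-- The number `f(a) = |a|' + c(a) - r(a)` for an entry with letter `k` in the box `b`. -/
def shiftIndex {d : ℕ} {μ κ : Fin d → ℕ} (k : Fin d) (b : Box μ κ) : ℤ :=
  ((d : ℤ) - (k : ℕ)) + (b.col : ℤ) - ((b.row : ℕ) : ℤ)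

/-- The factorial skew Schur function `s_{μ/κ}(x|y)`, an element of `ℂ[y_i][x_1, …, x_d]`. -/
noncomputable def factorialSkewSchur {d : ℕ} (μ κ : Fin d → ℕ) : MvPolynomial (Fin d) YRing :=
  ∑ R ∈ reverseTableaux μ κ, ∏ b : Box μ κ,
    (MvPolynomial.X (R b) - MvPolynomial.C (MvPolynomial.X (shiftIndex (R b) b)))

/-- The factorial Schur function `s_μ(x|y)`. -/
noncomputable def factorialSchur {d : ℕ} (μ : Fin d → ℕ) : MvPolynomial (Fin d) YRing :=
  factorialSkewSchur μ 0

/-- The polynomial `c_{λ * B}`: the product over the barred entries `a` of `B` of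
`y_{|a|' + ω((λ * B)^u_{<a})_{|a|}} - y_{|a|' + c(a) - r(a)}`. -/
noncomputable def coeffStar {d : ℕ} (lam : Fin d → ℕ) {μ κ : Fin d → ℕ}
    (B : Box μ κ → Fin d × Bool) : YRing :=
  ∏ a : Box μ κ with (B a).2 = true,
    (MvPolynomial.X (((d : ℤ) - ((B a).1 : ℕ)) + (content (starWordBefore lam B a) (B a).1 : ℤ))
      - MvPolynomial.X (shiftIndex (B a).1 a))

end FactorialLR

namespace FactorialLR
open MvPolynomial Finset

/-! For an exponent vector `m`, `alternant m p` is the signed sum over permutations `w` of the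
images under `w` of `(x_1|y)^{m_1} ⋯ (x_d|y)^{m_d} p`. Let `δ = (d-1, …, 0)` and `a_m = alternant m
1`. The core is an expansion of `a_{λ+δ} s_{μ/κ}(x|y)` into alternants
(`alternant_mul_factorialSkewSchur`).

The polynomial `s_{μ/κ}` is symmetric, so the product is `alternant (λ+δ) s_{μ/κ}`, which is
expanded one box at a time in reading order. If a box holds `k`, its factor splits as `x_k - y =
(x_k - y_{m_k+1}) + (y_{m_k+1} - y)`. The first term raises `m_k` by one: this is the unbarred
entry. The second is a scalar: this is the barred entry, and it is exactly the corresponding factor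
of `c_{λ*B}` (`alternant_linear_mul`). If an unbarred `i+1` breaks the Yamanouchi condition, the
exponents at `i` and `i+1` become equal, while the sum over the unread boxes is symmetric in `x_i`,
`x_{i+1}` (`isSwapInvariant_tableauSum`); so the alternant vanishes (`alternant_eq_zero`). This
partial symmetry is the main technical point and is proved column by column
(`isSwapInvariant_columnSum_aux`).

For `λ = 0` and `κ = ∅` just one tableau has a nonzero coefficient (`eq_canonicalTableau`), giving
the bialternant formula `a_δ s_μ = a_{μ+δ}`. Applying it to `λ` and to every `λ + ω(B^u)`, and
cancelling `a_δ ≠ 0`, turns the expansion into the theorem. -/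

/-- The linear factor contributed by the letter `k` in the box of row `r` and column `c`. -/
noncomputable def boxFactor {d : ℕ} (k : Fin d) (c : ℕ) (r : Fin d) : MvPolynomial (Fin d) YRing :=
  X k - C (X (((d : ℤ) - (k : ℕ)) + (c : ℤ) - ((r : ℕ) : ℤ)))

/-- Invariance of a polynomial under the transposition of two variables. -/
def IsSwapInvariant {d : ℕ} (i j : Fin d) (p : MvPolynomial (Fin d) YRing) : Prop :=
  rename (Equiv.swap i j) p = p

/-! ### Polynomials invariant under exchanging two variables. -/

section SwapInvariant
variable {d : ℕ} {i j : Fin d}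

theorem IsSwapInvariant.add {p q : MvPolynomial (Fin d) YRing} (hp : IsSwapInvariant i j p)
    (hq : IsSwapInvariant i j q) : IsSwapInvariant i j (p + q) := by
  unfold IsSwapInvariant at *; rw [map_add, hp, hq]

theorem IsSwapInvariant.sub {p q : MvPolynomial (Fin d) YRing} (hp : IsSwapInvariant i j p)
    (hq : IsSwapInvariant i j q) : IsSwapInvariant i j (p - q) := by
  unfold IsSwapInvariant at *; rw [map_sub, hp, hq]

theorem IsSwapInvariant.mul {p q : MvPolynomial (Fin d) YRing} (hp : IsSwapInvariant i j p)
    (hq : IsSwapInvariant i j q) : IsSwapInvariant i j (p * q) := by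
  unfold IsSwapInvariant at *; rw [map_mul, hp, hq]

theorem isSwapInvariant_zero : IsSwapInvariant i j 0 := map_zero _

theorem isSwapInvariant_one : IsSwapInvariant i j 1 := map_one _

theorem isSwapInvariant_sum {ι : Type*} {s : Finset ι} {f : ι → MvPolynomial (Fin d) YRing}
    (h : ∀ a ∈ s, IsSwapInvariant i j (f a)) : IsSwapInvariant i j (∑ a ∈ s, f a) := by
  unfold IsSwapInvariant at *; rw [map_sum]; exact sum_congr rfl h

theorem isSwapInvariant_prod {ι : Type*} {s : Finset ι} {f : ι → MvPolynomial (Fin d) YRing}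
    (h : ∀ a ∈ s, IsSwapInvariant i j (f a)) : IsSwapInvariant i j (∏ a ∈ s, f a) := by
  unfold IsSwapInvariant at *; rw [map_prod]; exact prod_congr rfl h

theorem rename_boxFactor (σ : Fin d → Fin d) (k : Fin d) (c : ℕ) (r : Fin d) :
    rename σ (boxFactor k c r) =
      X (σ k) - C (X (((d : ℤ) - (k : ℕ)) + (c : ℤ) - ((r : ℕ) : ℤ))) := by
  simp [boxFactor]

theorem isSwapInvariant_boxFactor {k : Fin d} (hi : k ≠ i) (hj : k ≠ j) (c : ℕ) (r : Fin d) :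
    IsSwapInvariant i j (boxFactor k c r) := by
  unfold IsSwapInvariant
  rw [rename_boxFactor, Equiv.swap_apply_of_ne_of_ne hi hj]; rfl

theorem isSwapInvariant_boxFactor_add (c : ℕ) (r : Fin d) :
    IsSwapInvariant i j (boxFactor i c r + boxFactor j c r) := by
  unfold IsSwapInvariant
  rw [map_add, rename_boxFactor, rename_boxFactor, Equiv.swap_apply_left, Equiv.swap_apply_right]
  unfold boxFactor; ring

/-- The hypothesis says that both factors involve the same `y`. It holds for `i` directly above `j =
i + 1` in a column, and also for `j` directly to the left of `i` in a row, the pair that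
semistandardness forbids. -/
theorem isSwapInvariant_boxFactor_mul {c c' : ℕ} {r r' : Fin d}
    (h : (c : ℤ) - (i : ℕ) - (r : ℕ) = (c' : ℤ) - (j : ℕ) - (r' : ℕ)) :
    IsSwapInvariant i j (boxFactor i c r * boxFactor j c' r') := by
  unfold IsSwapInvariant
  rw [map_mul, rename_boxFactor, rename_boxFactor, Equiv.swap_apply_left, Equiv.swap_apply_right]
  unfold boxFactor
  rw [show ((d : ℤ) - (j : ℕ)) + (c' : ℤ) - (r' : ℕ) = ((d : ℤ) - (i : ℕ)) + (c : ℤ) - (r : ℕ) by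
    linarith]
  ring

end SwapInvariant

/-! ### Symmetry of sums over fillings, column by column. -/

section Columns
variable {d : ℕ} (μ κ : Fin d → ℕ)

/-- The `c`-th column of `μ/κ` (the first column has number `1`) has a box in row `r`. -/
def InColumn (c : ℕ) (r : Fin d) : Prop := κ r < c ∧ c ≤ μ r

instance (c : ℕ) (r : Fin d) : Decidable (InColumn μ κ c r) :=
  inferInstanceAs (Decidable (_ ∧ _))

/-- The entries strictly increase down the `c`-th column. -/
def IsStrictColumn (c : ℕ) (v : Fin d → Fin d) : Prop :=
  ∀ r s, InColumn μ κ c r → InColumn μ κ c s → r < s → v s < v r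

instance (c : ℕ) (v : Fin d → Fin d) : Decidable (IsStrictColumn μ κ c v) :=
  inferInstanceAs (Decidable (∀ _, _))

/-- The strict fillings of the `c`-th column, extended by the identity to the other rows. -/
def strictColumns (c : ℕ) : Finset (Fin d → Fin d) :=
  univ.filter fun v => (∀ r, ¬ InColumn μ κ c r → v r = r) ∧ IsStrictColumn μ κ c v

/-- The weight of a filling of the column number `c + 1`. -/
noncomputable def columnWeight (c : ℕ) (v : Fin d → Fin d) : MvPolynomial (Fin d) YRing :=
  ∏ r with InColumn μ κ (c + 1) r, boxFactor (v r) c r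

/-- The filling `v` of column `c + 1` may stand to the left of the filling `u` of column `c`. -/
def ColumnLE (c : ℕ) (u v : Fin d → Fin d) : Prop :=
  ∀ r, InColumn μ κ c r → InColumn μ κ (c + 1) r → v r ≤ u r

instance (c : ℕ) (u v : Fin d → Fin d) : Decidable (ColumnLE μ κ c u v) :=
  inferInstanceAs (Decidable (∀ _, _))

/-- The generating function of the fillings of the `n` columns following the column `c`,
when column `c` is filled by `u`. -/
noncomputable def columnSum : ℕ → ℕ → (Fin d → Fin d) → MvPolynomial (Fin d) YRing
  | 0, _, _ => 1
  | n + 1, c, u => ∑ v ∈ strictColumns μ κ (c + 1) with ColumnLE μ κ c u v,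
      columnWeight μ κ c v * columnSum n (c + 1) v

/-- The letter `i` occurs in the column `c` filled by `v`. -/
def Occurs (c : ℕ) (v : Fin d → Fin d) (i : Fin d) : Prop := ∃ r, InColumn μ κ c r ∧ v r = i

instance (c : ℕ) (v : Fin d → Fin d) (i : Fin d) : Decidable (Occurs μ κ c v i) :=
  inferInstanceAs (Decidable (∃ _, _))

/-- Replace the letter `i` in column `c` by the letter `j`. -/
def replaceLetter (c : ℕ) (i j : Fin d) (v : Fin d → Fin d) : Fin d → Fin d :=
  fun r => if InColumn μ κ c r ∧ v r = i then j else v r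

variable {μ κ}

theorem IsStrictColumn.injective {c : ℕ} {v : Fin d → Fin d} (hv : IsStrictColumn μ κ c v)
    {r s : Fin d} (hr : InColumn μ κ c r) (hs : InColumn μ κ c s) (h : v r = v s) : r = s := by
  rcases lt_trichotomy r s with h' | h' | h'
  · exact absurd h (hv r s hr hs h').ne'
  · exact h'
  · exact absurd h (hv s r hs hr h').ne

theorem IsStrictColumn.lt_of_lt {c : ℕ} {v : Fin d → Fin d} (hv : IsStrictColumn μ κ c v)
    {r s : Fin d} (hr : InColumn μ κ c r) (hs : InColumn μ κ c s) (h : v r < v s) : s < r := by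
  rcases lt_trichotomy r s with h' | h' | h'
  · exact absurd (hv r s hr hs h') h.not_gt
  · exact absurd h (by simp [h'])
  · exact h'

theorem InColumn.of_le {c : ℕ} (hμ : Antitone μ) {r s : Fin d}
    (hr : InColumn μ κ c r) (h : r ≤ s) (hs : InColumn μ κ (c + 1) s) : InColumn μ κ (c + 1) r :=
  ⟨hr.1.trans (Nat.lt_succ_self c), hs.2.trans (hμ h)⟩

theorem InColumn.of_ge {c : ℕ} (hκ : Antitone κ) {r s : Fin d}
    (hr : InColumn μ κ c r) (h : r ≤ s) (hs : InColumn μ κ (c + 1) s) : InColumn μ κ c s :=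
  ⟨(hκ h).trans_lt hr.1, by have := hs.2; omega⟩

theorem InColumn.between {c : ℕ} (hμ : Antitone μ) (hκ : Antitone κ) {r s t : Fin d}
    (hr : InColumn μ κ c r) (ht : InColumn μ κ c t) (h : r ≤ s) (h' : s ≤ t) :
    InColumn μ κ c s :=
  ⟨(hκ h).trans_lt hr.1, ht.2.trans (hμ h')⟩

theorem mem_strictColumns {c : ℕ} {v : Fin d → Fin d} : v ∈ strictColumns μ κ c ↔
    (∀ r, ¬ InColumn μ κ c r → v r = r) ∧ IsStrictColumn μ κ c v := by
  simp [strictColumns]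

theorem replaceLetter_of_ne {c : ℕ} {i j r : Fin d} {v : Fin d → Fin d} (h : v r ≠ i) :
    replaceLetter μ κ c i j v r = v r := by simp [replaceLetter, h]

theorem replaceLetter_of_eq {c : ℕ} {i j r : Fin d} {v : Fin d → Fin d}
    (hr : InColumn μ κ c r) (h : v r = i) : replaceLetter μ κ c i j v r = j := by
  simp [replaceLetter, h, hr]

theorem not_occurs_replaceLetter {c : ℕ} {i j : Fin d} {v : Fin d → Fin d} (hij : j ≠ i) :
    ¬ Occurs μ κ c (replaceLetter μ κ c i j v) i := by
  rintro ⟨r, hr, h⟩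
  by_cases hv : v r = i
  · rw [replaceLetter_of_eq hr hv] at h; exact hij h
  · rw [replaceLetter_of_ne hv] at h; exact hv h

theorem occurs_replaceLetter {c : ℕ} {i j : Fin d} {v : Fin d → Fin d}
    (h : Occurs μ κ c v i) : Occurs μ κ c (replaceLetter μ κ c i j v) j :=
  let ⟨r, hr, h⟩ := h; ⟨r, hr, replaceLetter_of_eq hr h⟩

theorem replaceLetter_replaceLetter {c : ℕ} {i j : Fin d} {v : Fin d → Fin d}
    (hj : ¬ Occurs μ κ c v j) : replaceLetter μ κ c j i (replaceLetter μ κ c i j v) = v := by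
  funext r
  by_cases hr : InColumn μ κ c r
  · have : v r ≠ j := fun h => hj ⟨r, hr, h⟩
    by_cases hv : v r = i
    · rw [replaceLetter_of_eq hr (replaceLetter_of_eq hr hv), hv]
    · rw [replaceLetter_of_ne, replaceLetter_of_ne hv]
      rwa [replaceLetter_of_ne hv]
  · simp [replaceLetter, hr]

theorem replaceLetter_mem {c : ℕ} {i j : Fin d} (hij : (j : ℕ) = i + 1 ∨ (i : ℕ) = j + 1)
    {v : Fin d → Fin d} (hv : v ∈ strictColumns μ κ c) (hj : ¬ Occurs μ κ c v j) :
    replaceLetter μ κ c i j v ∈ strictColumns μ κ c := by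
  rw [mem_strictColumns] at *
  refine ⟨fun r hr => by simp [replaceLetter, hr, hv.1 r hr], fun r s hr hs hrs => ?_⟩
  have h := hv.2 r s hr hs hrs
  have h1 : v r ≠ j := fun h => hj ⟨r, hr, h⟩
  have h2 : v s ≠ j := fun h => hj ⟨s, hs, h⟩
  simp only [replaceLetter, hr, hs, true_and]
  simp only [Fin.lt_def, ne_eq, Fin.ext_iff] at *
  split_ifs <;> omega

/-- Split a sum over columns according to the occurrences of the letters `i` and `j`. -/
theorem sum_strictColumns_filter {c : ℕ} {i j : Fin d} (hij : (j : ℕ) = i + 1)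
    (P : (Fin d → Fin d) → Prop) [DecidablePred P] {M : Type*} [AddCommMonoid M]
    (F : (Fin d → Fin d) → M) :
    ∑ v ∈ strictColumns μ κ c with P v, F v =
      ∑ v ∈ strictColumns μ κ c with (Occurs μ κ c v i ↔ Occurs μ κ c v j) ∧ P v, F v +
      ∑ v ∈ strictColumns μ κ c with Occurs μ κ c v i ∧ ¬ Occurs μ κ c v j,
        ((if P v then F v else 0) +
          if P (replaceLetter μ κ c i j v) then F (replaceLetter μ κ c i j v) else 0) := by
  have hne : j ≠ i := by rw [ne_eq, Fin.ext_iff]; omega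
  have h1 : ∑ v ∈ strictColumns μ κ c with Occurs μ κ c v i ∧ ¬ Occurs μ κ c v j,
        (if P (replaceLetter μ κ c i j v) then F (replaceLetter μ κ c i j v) else 0) =
      ∑ v ∈ strictColumns μ κ c with ¬ Occurs μ κ c v i ∧ Occurs μ κ c v j,
        if P v then F v else 0 := by
    refine sum_nbij' (replaceLetter μ κ c i j) (replaceLetter μ κ c j i) ?_ ?_ ?_ ?_ ?_
    · intro v hv
      rw [mem_filter] at hv ⊢
      exact ⟨replaceLetter_mem (Or.inl hij) hv.1 hv.2.2, not_occurs_replaceLetter hne,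
        occurs_replaceLetter hv.2.1⟩
    · intro v hv
      rw [mem_filter] at hv ⊢
      exact ⟨replaceLetter_mem (Or.inr hij) hv.1 hv.2.1, occurs_replaceLetter hv.2.2,
        not_occurs_replaceLetter hne.symm⟩
    · intro v hv
      exact replaceLetter_replaceLetter (mem_filter.1 hv).2.2
    · intro v hv
      exact replaceLetter_replaceLetter (mem_filter.1 hv).2.1
    · intro v hv; rfl
  rw [sum_add_distrib, h1, sum_filter, sum_filter, sum_filter, sum_filter, ← sum_add_distrib,
    ← sum_add_distrib]
  refine sum_congr rfl fun v _ => ?_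
  by_cases hi : Occurs μ κ c v i <;> by_cases hj : Occurs μ κ c v j <;> simp [hi, hj]

/-- Raising `i` to `j` in row `r` can only fail if `u` has `i` there. Then `u` has `j` in a lower
row, and the entry of `v` in that row is greater than `i` and at most `j`, so `v` already contains
`j`. -/
theorem columnLE_replaceLetter {c : ℕ} {i j : Fin d} (hij : (j : ℕ) = i + 1) (hμ : Antitone μ)
    {u v : Fin d → Fin d} (hus : IsStrictColumn μ κ c u)
    (hu : Occurs μ κ c u i → Occurs μ κ c u j)
    (hvs : IsStrictColumn μ κ (c + 1) v) (hv : ¬ Occurs μ κ (c + 1) v j) :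
    ColumnLE μ κ c u (replaceLetter μ κ (c + 1) i j v) ↔ ColumnLE μ κ c u v := by
  constructor
  · intro h r hr hr'
    refine le_trans ?_ (h r hr hr')
    simp only [replaceLetter]
    split_ifs with h'
    · rw [h'.2, Fin.le_def]; omega
    · exact le_rfl
  · intro h r hr hr'
    have h0 := h r hr hr'
    by_cases hvr : v r = i
    · rw [replaceLetter_of_eq hr' hvr]
      by_contra hlt
      have hur : u r = i := by
        rw [hvr] at h0; simp only [Fin.le_def, Fin.ext_iff] at *; omega
      obtain ⟨s, hs, hus'⟩ := hu ⟨r, hr, hur⟩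
      have hsr : s < r := hus.lt_of_lt hr hs (by rw [hur, hus', Fin.lt_def]; omega)
      have hs' := hs.of_le hμ hsr.le hr'
      have h2 := h s hs hs'
      have h3 := hvs s r hs' hr' hsr
      refine hv ⟨s, hs', ?_⟩
      rw [hus'] at h2; rw [hvr] at h3
      simp only [Fin.le_def, Fin.lt_def, Fin.ext_iff] at *; omega
    · rwa [replaceLetter_of_ne hvr]

/-- The part of the weight of a column that comes from the rows other than `r`. -/
noncomputable def columnWeightErase (μ κ : Fin d → ℕ) (c : ℕ) (v : Fin d → Fin d) (r : Fin d) :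
    MvPolynomial (Fin d) YRing :=
  ∏ s ∈ (univ.filter (InColumn μ κ (c + 1))).erase r, boxFactor (v s) c s

theorem columnWeight_eq {c : ℕ} (v : Fin d → Fin d) {r : Fin d} (hr : InColumn μ κ (c + 1) r) :
    columnWeight μ κ c v = boxFactor (v r) c r * columnWeightErase μ κ c v r :=
  (mul_prod_erase _ _ (by simp [hr])).symm

theorem columnWeight_replaceLetter {c : ℕ} {i j : Fin d} {v : Fin d → Fin d}
    (hvs : IsStrictColumn μ κ (c + 1) v) {r : Fin d} (hr : InColumn μ κ (c + 1) r) (hv : v r = i) :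
    columnWeight μ κ c (replaceLetter μ κ (c + 1) i j v) =
      boxFactor j c r * columnWeightErase μ κ c v r := by
  rw [columnWeight_eq _ hr, replaceLetter_of_eq hr hv]
  congr 1
  refine prod_congr rfl fun s hs => ?_
  rw [mem_erase, mem_filter] at hs
  rw [replaceLetter_of_ne]
  exact fun h => hs.1 (hvs.injective hs.2.2 hr (h.trans hv.symm))

theorem isSwapInvariant_columnWeightErase {c : ℕ} {i j : Fin d} {v : Fin d → Fin d}
    (hvs : IsStrictColumn μ κ (c + 1) v) {r : Fin d} (hr : InColumn μ κ (c + 1) r) (hv : v r = i)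
    (hj : ¬ Occurs μ κ (c + 1) v j) :
    IsSwapInvariant i j (columnWeightErase μ κ c v r) := by
  refine isSwapInvariant_prod fun s hs => ?_
  rw [mem_erase, mem_filter] at hs
  exact isSwapInvariant_boxFactor
    (fun h => hs.1 (hvs.injective hs.2.2 hr (h.trans hv.symm))) (fun h => hj ⟨s, hs.2.2, h⟩) _ _

/-- If both letters occur, they are in adjacent rows, since no letter lies strictly between them;
their two factors then involve the same `y`. -/
theorem isSwapInvariant_columnWeight {c : ℕ} {i j : Fin d} (hij : (j : ℕ) = i + 1)
    (hμ : Antitone μ) (hκ : Antitone κ) {v : Fin d → Fin d}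
    (hvs : IsStrictColumn μ κ (c + 1) v)
    (hv : Occurs μ κ (c + 1) v i ↔ Occurs μ κ (c + 1) v j) :
    IsSwapInvariant i j (columnWeight μ κ c v) := by
  by_cases hi : Occurs μ κ (c + 1) v i
  · obtain ⟨s, hs, hsj⟩ := hv.1 hi
    obtain ⟨r, hr, hri⟩ := hi
    have hsr : s < r := hvs.lt_of_lt hr hs (by rw [hri, hsj, Fin.lt_def]; omega)
    have hadj : (r : ℕ) = s + 1 := by
      by_contra hne
      have hsr' : (s : ℕ) < r := hsr
      have hlt : (s : ℕ) + 1 < r := by omega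
      let t : Fin d := ⟨s + 1, by omega⟩
      have hst : s < t := by rw [Fin.lt_def]; simp [t]
      have htr : t < r := by rw [Fin.lt_def]; simpa [t] using hlt
      have ht := hs.between hμ hκ hr hst.le htr.le
      have h1 := hvs s t hs ht hst
      have h2 := hvs t r ht hr htr
      rw [hsj] at h1; rw [hri] at h2
      rw [Fin.lt_def] at h1 h2; omega
    rw [columnWeight_eq _ hr, columnWeightErase,
      ← mul_prod_erase _ _ (show s ∈ (univ.filter (InColumn μ κ (c + 1))).erase r by
        simp [hs, hsr.ne]), ← mul_assoc, hri, hsj]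
    refine (isSwapInvariant_boxFactor_mul (by rw [hij, hadj]; push_cast; ring)).mul
      (isSwapInvariant_prod fun t ht => ?_)
    rw [mem_erase, mem_erase, mem_filter] at ht
    exact isSwapInvariant_boxFactor
      (fun h => ht.2.1 (hvs.injective ht.2.2.2 hr (h.trans hri.symm)))
      (fun h => ht.1 (hvs.injective ht.2.2.2 hs (h.trans hsj.symm))) _ _
  · refine isSwapInvariant_prod fun t ht => ?_
    rw [mem_filter] at ht
    exact isSwapInvariant_boxFactor (fun h => hi ⟨t, ht.2, h⟩)
      (fun h => hi (hv.2 ⟨t, ht.2, h⟩)) _ _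

/-- The symmetry of `columnSum`, in a form suited to induction: `columnSum` is invariant if an
occurrence of `i` in the given column implies one of `j`; and if the given column is allowed to
vary by exchanging `i` and `j`, the weighted sum of the two possibilities is invariant. -/
theorem isSwapInvariant_columnSum_aux {i j : Fin d} (hij : (j : ℕ) = i + 1)
    (hμ : Antitone μ) (hκ : Antitone κ) (n : ℕ) :
    (∀ c u, IsStrictColumn μ κ c u → (Occurs μ κ c u i → Occurs μ κ c u j) →
      IsSwapInvariant i j (columnSum μ κ n c u)) ∧
    (∀ c u r, u ∈ strictColumns μ κ (c + 1) → InColumn μ κ (c + 1) r → u r = i →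
      ¬ Occurs μ κ (c + 1) u j →
      IsSwapInvariant i j (boxFactor i c r * columnSum μ κ n (c + 1) u +
        boxFactor j c r * columnSum μ κ n (c + 1) (replaceLetter μ κ (c + 1) i j u))) := by
  have hne : j ≠ i := by rw [ne_eq, Fin.ext_iff]; omega
  induction n with
  | zero =>
    refine ⟨fun _ _ _ _ => isSwapInvariant_one, fun c u r _ _ _ _ => ?_⟩
    simpa [columnSum] using isSwapInvariant_boxFactor_add c r
  | succ n ih =>
    obtain ⟨ih1, ih2⟩ := ih
    have hS : ∀ c v, v ∈ strictColumns μ κ (c + 1) →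
        (Occurs μ κ (c + 1) v i ↔ Occurs μ κ (c + 1) v j) →
        IsSwapInvariant i j (columnWeight μ κ c v * columnSum μ κ n (c + 1) v) := by
      intro c v hv h
      have hvs := (mem_strictColumns.1 hv).2
      exact (isSwapInvariant_columnWeight hij hμ hκ hvs h).mul (ih1 _ _ hvs h.1)
    have hK : ∀ c v, v ∈ strictColumns μ κ (c + 1) → Occurs μ κ (c + 1) v i →
        ¬ Occurs μ κ (c + 1) v j →
        IsSwapInvariant i j (columnWeight μ κ c v * columnSum μ κ n (c + 1) v +
          columnWeight μ κ c (replaceLetter μ κ (c + 1) i j v) *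
            columnSum μ κ n (c + 1) (replaceLetter μ κ (c + 1) i j v)) := by
      rintro c v hv ⟨r, hr, hri⟩ hj
      have hvs := (mem_strictColumns.1 hv).2
      rw [columnWeight_replaceLetter hvs hr hri, columnWeight_eq v hr, hri]
      convert (isSwapInvariant_columnWeightErase hvs hr hri hj).mul (ih2 c v r hv hr hri hj)
        using 1
      ring
    refine ⟨fun c u hu hocc => ?_, fun c u r hu hr hur hnj => ?_⟩
    · rw [columnSum, sum_strictColumns_filter hij]
      refine (isSwapInvariant_sum fun v hv => ?_).add (isSwapInvariant_sum fun v hv => ?_)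
      · rw [mem_filter] at hv
        exact hS c v hv.1 hv.2.1
      · rw [mem_filter] at hv
        simp only [columnLE_replaceLetter hij hμ hu hocc (mem_strictColumns.1 hv.1).2 hv.2.2]
        split_ifs
        · exact hK c v hv.1 hv.2.1 hv.2.2
        · simpa using isSwapInvariant_zero
    · have hus := (mem_strictColumns.1 hu).2
      set u' := replaceLetter μ κ (c + 1) i j u with hu'
      have hu's : IsStrictColumn μ κ (c + 1) u' :=
        (mem_strictColumns.1 (replaceLetter_mem (Or.inl hij) hu hnj)).2
      have hu'i : ¬ Occurs μ κ (c + 1) u' i := not_occurs_replaceLetter hne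
      have hu'r : u' r = j := replaceLetter_of_eq hr hur
      have hu'ne : ∀ s, InColumn μ κ (c + 1) s → s ≠ r → u' s = u s := fun s hs hsr =>
        replaceLetter_of_ne fun h => hsr (hus.injective hs hr (h.trans hur.symm))
      have hle : ∀ v : Fin d → Fin d, (InColumn μ κ (c + 2) r → v r ≠ j) →
          (ColumnLE μ κ (c + 1) u v ↔ ColumnLE μ κ (c + 1) u' v) := by
        intro v hv
        refine forall_congr' fun s => forall_congr' fun hs => forall_congr' fun hs' => ?_
        by_cases hsr : s = r
        · subst hsr
          have := hv hs'
          rw [hur, hu'r]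
          simp only [Fin.le_def, ne_eq, Fin.ext_iff] at *; omega
        · rw [hu'ne s hs hsr]
      -- The columns `u` and `u'` differ only in row `r`, so only `v r = j` could distinguish them.
      -- In that case `v` has `i` in a higher row, where `u` and `u'` have an entry less than `i`,
      -- and both comparisons fail.
      have hLE_S : ∀ v ∈ strictColumns μ κ (c + 2),
          (Occurs μ κ (c + 2) v i ↔ Occurs μ κ (c + 2) v j) →
          (ColumnLE μ κ (c + 1) u v ↔ ColumnLE μ κ (c + 1) u' v) := by
        intro v hv hocc
        have hvs := (mem_strictColumns.1 hv).2
        by_cases hrj : InColumn μ κ (c + 2) r ∧ v r = j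
        · obtain ⟨hr2, hrj⟩ := hrj
          obtain ⟨s, hs, hsi⟩ := hocc.2 ⟨r, hr2, hrj⟩
          have hrs : r < s := hvs.lt_of_lt hs hr2 (by rw [hsi, hrj, Fin.lt_def]; omega)
          have hs1 := hr.of_ge hκ hrs.le hs
          have hsu := hus r s hr hs1 hrs
          refine iff_of_false (fun h => ?_) (fun h => ?_)
          · have := h s hs1 hs
            rw [hsi] at this; rw [hur] at hsu; exact absurd hsu this.not_gt
          · have := h s hs1 hs
            rw [hsi, hu'ne s hs1 hrs.ne'] at this; rw [hur] at hsu; exact absurd hsu this.not_gt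
        · exact hle v fun h h' => hrj ⟨h, h'⟩
      have hLE_K : ∀ v : Fin d → Fin d, ¬ Occurs μ κ (c + 2) v j →
          (ColumnLE μ κ (c + 1) u v ↔ ColumnLE μ κ (c + 1) u' v) :=
        fun v hv => hle v fun h h' => hv ⟨r, h, h'⟩
      have hLE_K' : ∀ v ∈ strictColumns μ κ (c + 2), ¬ Occurs μ κ (c + 2) v j →
          (ColumnLE μ κ (c + 1) u' (replaceLetter μ κ (c + 2) i j v) ↔
            ColumnLE μ κ (c + 1) u' v) := fun v hv hv' =>
        columnLE_replaceLetter hij hμ hu's (fun h => absurd h hu'i) (mem_strictColumns.1 hv).2 hv'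
      rw [columnSum, columnSum, sum_strictColumns_filter hij (ColumnLE μ κ (c + 1) u),
        sum_strictColumns_filter hij (ColumnLE μ κ (c + 1) u'),
        filter_congr (p := fun v => (Occurs μ κ (c + 1 + 1) v i ↔ Occurs μ κ (c + 1 + 1) v j) ∧
          ColumnLE μ κ (c + 1) u v) (s := strictColumns μ κ (c + 1 + 1))
          (fun v hv => and_congr_right fun h => hLE_S v hv h)]
      rw [mul_add, mul_add, add_add_add_comm, ← add_mul, mul_sum, mul_sum, mul_sum, ← sum_add_distrib]
      refine IsSwapInvariant.add (isSwapInvariant_sum fun v hv => ?_)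
        (isSwapInvariant_sum fun v hv => ?_)
      · rw [mem_filter] at hv
        refine (isSwapInvariant_boxFactor_add c r).mul ?_
        exact hS _ v hv.1 hv.2.1
      · rw [mem_filter] at hv
        obtain ⟨hv, hvi, hvj⟩ := hv
        have hvs := (mem_strictColumns.1 hv).2
        simp only [hLE_K v hvj, hLE_K' v hv hvj]
        by_cases hP : ColumnLE μ κ (c + 1) u' v
        · simp only [hP, if_true]
          by_cases hvr : InColumn μ κ (c + 2) r ∧ v r = i
          · obtain ⟨hr2, hvr⟩ := hvr
            rw [if_neg (fun h => by
              have := h r hr hr2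
              rw [replaceLetter_of_eq hr2 hvr, hur, Fin.le_def] at this; omega)]
            rw [columnWeight_replaceLetter hvs hr2 hvr, columnWeight_eq v hr2, hvr]
            have hW := isSwapInvariant_columnWeightErase hvs hr2 hvr hvj
            have hH := ih2 (c + 1) v r hv hr2 hvr hvj
            have hZ := ih1 (c + 2) (replaceLetter μ κ (c + 2) i j v)
              (mem_strictColumns.1 (replaceLetter_mem (Or.inl hij) hv hvj)).2
              (fun h => absurd h (not_occurs_replaceLetter hne))
            have hM : IsSwapInvariant i j (boxFactor i c r * boxFactor j (c + 1) r) :=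
              isSwapInvariant_boxFactor_mul (by rw [hij]; push_cast; ring)
            -- Row `r` admits the pairs `(i, i)`, `(j, i)`, `(j, j)` of entries of the given column
            -- and of `v`. Their sum is that over all four pairs, a product of invariant factors,
            -- minus the forbidden `(i, j)`, which is invariant by `hM`, `hW` and `hZ`.
            convert ((isSwapInvariant_boxFactor_add c r).mul (hW.mul hH)).sub (hM.mul (hW.mul hZ))
              using 1
            ring
          · rw [if_pos]
            · rw [← add_mul]
              exact (isSwapInvariant_boxFactor_add c r).mul (hK _ v hv hvi hvj)
            · refine (hle _ fun h h' => ?_).2 ((hLE_K' v hv hvj).2 hP)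
              by_cases hvr' : v r = i
              · exact hvr ⟨h, hvr'⟩
              · rw [replaceLetter_of_ne hvr'] at h'; exact hvj ⟨r, h, h'⟩
        · rw [if_neg hP, if_neg hP, if_neg (fun h => hP ?_)]
          · simpa using isSwapInvariant_zero
          · refine (hLE_K v hvj).1 fun s hs hs' => le_trans ?_ (h s hs hs')
            simp only [replaceLetter]
            split_ifs with h'
            · rw [h'.2, Fin.le_def]; omega
            · exact le_rfl

theorem isSwapInvariant_columnSum {i j : Fin d} (hij : (j : ℕ) = i + 1)
    (hμ : Antitone μ) (hκ : Antitone κ) (n c : ℕ) {u : Fin d → Fin d}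
    (hu : IsStrictColumn μ κ c u) (h : Occurs μ κ c u i → Occurs μ κ c u j) :
    IsSwapInvariant i j (columnSum μ κ n c u) :=
  (isSwapInvariant_columnSum_aux hij hμ hκ n).1 c u hu h

end Columns
-- Sums over tableaux with prescribed entries, reduced to column sums.
section TableauSum
variable {d : ℕ} {μ κ : Fin d → ℕ}

theorem mem_boxes {b : Fin d × ℕ} : b ∈ boxes μ κ ↔ κ b.1 ≤ b.2 ∧ b.2 < μ b.1 := by
  simp only [boxes, mem_filter, mem_product, mem_univ, true_and, mem_range, and_iff_right_iff_imp]
  exact fun h => h.2.trans_le (le_sup (f := μ) (mem_univ b.1))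

theorem mem_boxes_iff_inColumn {r : Fin d} {c : ℕ} :
    (r, c) ∈ boxes μ κ ↔ InColumn μ κ (c + 1) r := by
  rw [mem_boxes, InColumn]; simp only [Nat.lt_succ_iff, Nat.succ_le_iff]

theorem Box.inColumn (b : Box μ κ) : InColumn μ κ (b.col + 1) b.row :=
  mem_boxes_iff_inColumn.1 b.2

/-- The box of row `r` and column `c`. -/
def InColumn.box {r : Fin d} {c : ℕ} (h : InColumn μ κ (c + 1) r) : Box μ κ :=
  ⟨(r, c), mem_boxes_iff_inColumn.2 h⟩

theorem InColumn.box_eq {b : Box μ κ} {c : ℕ} (hc : b.col = c)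
    (h : InColumn μ κ (c + 1) b.row) : h.box = b := by
  subst hc; rfl

theorem Box.ext' {p q : Box μ κ} (h1 : p.row = q.row) (h2 : p.col = q.col) : p = q :=
  Subtype.ext (Prod.ext h1 h2)

/-- The boxes of the first `c` columns. -/
def firstColumns (μ κ : Fin d → ℕ) (c : ℕ) : Finset (Box μ κ) := univ.filter fun b => b.col < c

theorem mem_firstColumns {c : ℕ} {b : Box μ κ} : b ∈ firstColumns μ κ c ↔ b.col < c := by
  simp [firstColumns]

/-- The conditions on a tableau, restricted to the boxes of a set. -/
def IsSemistandardOn (D : Finset (Box μ κ)) (T : Box μ κ → Fin d) : Prop :=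
  (∀ p ∈ D, ∀ q ∈ D, p.row = q.row → p.col < q.col → T q ≤ T p) ∧
  (∀ p ∈ D, ∀ q ∈ D, p.col = q.col → p.row < q.row → T q < T p)

/-- The generating function of the reverse tableaux that agree with `g` on `D`, where only the
boxes outside `D` contribute to the weight. -/
noncomputable def tableauSum (D : Finset (Box μ κ)) (g : Box μ κ → Fin d) :
    MvPolynomial (Fin d) YRing :=
  ∑ T ∈ reverseTableaux μ κ with ∀ q ∈ D, T q = g q, ∏ b ∈ Dᶜ, boxFactor (T b) b.col b.row

theorem tableauSum_empty (g : Box μ κ → Fin d) : tableauSum ∅ g = factorialSkewSchur μ κ := by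
  simp only [tableauSum, notMem_empty, false_imp_iff, implies_true, filter_true, compl_empty]
  rfl

theorem mem_reverseTableaux {T : Box μ κ → Fin d} :
    T ∈ reverseTableaux μ κ ↔ IsSemistandard T := by simp [reverseTableaux]

theorem isSemistandardOn_univ {T : Box μ κ → Fin d} :
    IsSemistandardOn univ T ↔ IsSemistandard T := by
  simp [IsSemistandardOn, IsSemistandard]

theorem tableauSum_univ (g : Box μ κ → Fin d) :
    tableauSum univ g = if IsSemistandard g then 1 else 0 := by
  have h : ∀ T : Box μ κ → Fin d, (∀ q ∈ univ, T q = g q) ↔ T = g := fun T => by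
    simp [funext_iff]
  simp only [tableauSum, compl_univ, prod_empty, h]
  split_ifs with hg
  · rw [filter_eq', if_pos (mem_reverseTableaux.2 hg), sum_singleton]
  · rw [filter_eq', if_neg (fun h => hg (mem_reverseTableaux.1 h)), sum_empty]

theorem tableauSum_eq_zero {D : Finset (Box μ κ)} {g : Box μ κ → Fin d}
    (h : ¬ IsSemistandardOn D g) : tableauSum D g = 0 := by
  rw [tableauSum, filter_false_of_mem, sum_empty]
  intro T hT hTg
  rw [mem_reverseTableaux] at hT
  refine h ⟨fun p hp q hq hr hc => ?_, fun p hp q hq hr hc => ?_⟩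
  · rw [← hTg p hp, ← hTg q hq]; exact hT.1 p q hr hc
  · rw [← hTg p hp, ← hTg q hq]; exact hT.2 p q hr hc

/-- Branching on the entry of one box. -/
theorem tableauSum_insert {D : Finset (Box μ κ)} {b : Box μ κ} (hb : b ∉ D)
    (g : Box μ κ → Fin d) :
    tableauSum D g = ∑ k : Fin d,
      boxFactor k b.col b.row * tableauSum (insert b D) (Function.update g b k) := by
  rw [tableauSum, ← sum_fiberwise _ (fun T => T b)]
  refine sum_congr rfl fun k _ => ?_
  rw [tableauSum, mul_sum]
  have h : ∀ T : Box μ κ → Fin d, (∀ q ∈ insert b D, T q = Function.update g b k q) ↔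
      (∀ q ∈ D, T q = g q) ∧ T b = k := by
    intro T
    rw [forall_mem_insert, Function.update_self, and_comm]
    refine and_congr_left' (forall₂_congr fun q hq => ?_)
    rw [Function.update_of_ne (ne_of_mem_of_not_mem hq hb)]
  simp only [h]
  rw [filter_filter]
  refine sum_congr rfl fun T hT => ?_
  rw [mem_filter] at hT
  rw [compl_insert, ← mul_prod_erase _ _ (mem_compl.2 hb), hT.2.2]

/-- The entries in column number `c + 1` of a tableau, extended by the identity. -/
def columnOf (T : Box μ κ → Fin d) (c : ℕ) : Fin d → Fin d :=
  fun r => if h : InColumn μ κ (c + 1) r then T h.box else r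

theorem columnOf_row (T : Box μ κ → Fin d) {c : ℕ} {b : Box μ κ} (hb : b.col = c) :
    columnOf T c b.row = T b := by
  subst hb
  rw [columnOf, dif_pos b.inColumn, InColumn.box_eq rfl]

/-- Overwrite the entries in column number `c + 1`. -/
def overlay (g : Box μ κ → Fin d) (c : ℕ) (v : Fin d → Fin d) : Box μ κ → Fin d :=
  fun b => if b.col = c then v b.row else g b

theorem columnOf_mem {T : Box μ κ → Fin d} (hT : IsSemistandard T) (c : ℕ) :
    columnOf T c ∈ strictColumns μ κ (c + 1) := by
  refine mem_strictColumns.2 ⟨fun r hr => dif_neg hr, fun r s hr hs hrs => ?_⟩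
  rw [columnOf, columnOf, dif_pos hr, dif_pos hs]
  exact hT.2 hr.box hs.box rfl hrs

theorem columnOf_eq_iff {T : Box μ κ → Fin d} {c : ℕ} {v : Fin d → Fin d}
    (hv : v ∈ strictColumns μ κ (c + 1)) :
    columnOf T c = v ↔ ∀ b : Box μ κ, b.col = c → T b = v b.row := by
  refine ⟨fun h b hb => by rw [← h, columnOf_row T hb], fun h => funext fun r => ?_⟩
  by_cases hr : InColumn μ κ (c + 1) r
  · rw [columnOf, dif_pos hr]; exact h hr.box rfl
  · rw [columnOf, dif_neg hr, (mem_strictColumns.1 hv).1 r hr]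

/-- Branching on the entries of one column, some of which may already be given. -/
theorem tableauSum_column {D : Finset (Box μ κ)} {c : ℕ} (h1 : firstColumns μ κ c ⊆ D)
    (h2 : D ⊆ firstColumns μ κ (c + 1)) (g : Box μ κ → Fin d) :
    tableauSum D g =
      ∑ v ∈ strictColumns μ κ (c + 1) with ∀ b ∈ D, b.col = c → v b.row = g b,
        (∏ b ∈ firstColumns μ κ (c + 1) \ D, boxFactor (v b.row) b.col b.row) *
          tableauSum (firstColumns μ κ (c + 1)) (overlay g c v) := by
  rw [tableauSum, ← sum_fiberwise_of_maps_to (g := fun T => columnOf T c)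
    (t := (strictColumns μ κ (c + 1)).filter fun v => ∀ b ∈ D, b.col = c → v b.row = g b)]
  · refine sum_congr rfl fun v hv => ?_
    rw [mem_filter] at hv
    rw [tableauSum, mul_sum, filter_filter]
    have h : ∀ T : Box μ κ → Fin d, ((∀ q ∈ D, T q = g q) ∧ columnOf T c = v) ↔
        ∀ q ∈ firstColumns μ κ (c + 1), T q = overlay g c v q := by
      intro T
      rw [columnOf_eq_iff hv.1]
      refine ⟨fun h q hq => ?_, fun h => ⟨fun q hq => ?_, fun q hq => ?_⟩⟩
      · rw [mem_firstColumns] at hq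
        by_cases hc : q.col = c
        · rw [overlay, if_pos hc, h.2 q hc]
        · rw [overlay, if_neg hc, h.1 q (h1 (mem_firstColumns.2 (by omega)))]
      · rw [h q (h2 hq), overlay]
        split_ifs with hc
        · exact hv.2 q hq hc
        · rfl
      · rw [h q (mem_firstColumns.2 (by omega)), overlay, if_pos hq]
    simp only [h]
    refine sum_congr rfl fun T hT => ?_
    rw [mem_filter] at hT
    rw [← prod_sdiff (compl_subset_compl.2 h2), compl_sdiff_compl]
    congr 1
    refine prod_congr rfl fun b hb => ?_
    rw [mem_sdiff, mem_firstColumns] at hb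
    have hc : b.col = c := by
      by_contra hc
      exact hb.2 (h1 (mem_firstColumns.2 (by omega)))
    rw [hT.2 b (mem_firstColumns.2 hb.1), overlay, if_pos hc]
  · intro T hT
    rw [mem_filter, mem_reverseTableaux] at hT
    rw [mem_filter]
    exact ⟨columnOf_mem hT.1 c, fun b hb hc => by rw [columnOf_row T hc, hT.2 b hb]⟩

theorem columnWeight_eq_prod (c : ℕ) (v : Fin d → Fin d) :
    columnWeight μ κ c v = ∏ b ∈ firstColumns μ κ (c + 1) \ firstColumns μ κ c,
      boxFactor (v b.row) b.col b.row := by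
  symm
  have hc : ∀ b ∈ firstColumns μ κ (c + 1) \ firstColumns μ κ c, b.col = c := by
    intro b hb
    rw [mem_sdiff, mem_firstColumns, mem_firstColumns] at hb; omega
  refine prod_bij (fun b _ => b.row) ?_ ?_ ?_ ?_
  · intro b hb
    rw [mem_filter, ← hc b hb]
    exact ⟨mem_univ _, b.inColumn⟩
  · intro p hp q hq h
    exact Box.ext' h ((hc p hp).trans (hc q hq).symm)
  · intro r hr
    rw [mem_filter] at hr
    exact ⟨hr.2.box, by simp [mem_firstColumns, InColumn.box, Box.col], rfl⟩
  · intro b hb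
    rw [hc b hb]

theorem isSemistandardOn_overlay_iff {c : ℕ} {g : Box μ κ → Fin d} {u v : Fin d → Fin d}
    (hv : v ∈ strictColumns μ κ (c + 1)) (hg : IsSemistandardOn (firstColumns μ κ c) g)
    (hu : ∀ b : Box μ κ, b.col + 1 = c → u b.row = g b) :
    IsSemistandardOn (firstColumns μ κ (c + 1)) (overlay g c v) ↔ ColumnLE μ κ c u v := by
  rw [mem_strictColumns] at hv
  constructor
  · intro h r hr hr'
    -- `InColumn` counts columns from `1` and `Box.col` from `0`; column number `0` is empty.
    obtain ⟨c, rfl⟩ : ∃ c', c = c' + 1 := ⟨c - 1, by have := hr.1; omega⟩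
    have h' := h.1 hr.box (by simp [mem_firstColumns, InColumn.box, Box.col]) hr'.box
      (by simp [mem_firstColumns, InColumn.box, Box.col]) rfl (Nat.lt_succ_self c)
    rw [overlay, overlay, if_pos (show hr'.box.col = c + 1 from rfl),
      if_neg (show ¬ hr.box.col = c + 1 from (Nat.succ_ne_self c).symm), ← hu hr.box rfl] at h'
    exact h'
  · intro h
    refine ⟨fun p hp q hq hr hc => ?_, fun p hp q hq hc hr => ?_⟩
    · rw [mem_firstColumns] at hp hq
      rw [overlay, overlay, if_neg (by omega : p.col ≠ c)]
      split_ifs with hqc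
      · obtain ⟨c, rfl⟩ : ∃ c', c = c' + 1 := ⟨c - 1, by omega⟩
        have hq' := q.inColumn
        rw [hqc] at hq'
        -- Each row is an interval, so the right neighbour of `q` is a box; comparison with `p`
        -- passes through it.
        have hin : InColumn μ κ (c + 1) q.row :=
          ⟨by have := p.inColumn.1; rw [hr] at this; omega, by have := hq'.2; omega⟩
        refine (h q.row hin hq').trans ?_
        have hb := hu hin.box rfl
        change u q.row = _ at hb
        rw [hb]
        by_cases hpc : p.col = c
        · rw [← hr] at hin; simp only [← hr]; rw [InColumn.box_eq hpc hin]
        · exact hg.1 p (mem_firstColumns.2 (by omega)) hin.box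
            (mem_firstColumns.2 (Nat.lt_succ_self c)) hr
            (show p.col < c by omega)
      · exact hg.1 p (mem_firstColumns.2 (by omega)) q (mem_firstColumns.2 (by omega)) hr hc
    · rw [mem_firstColumns] at hp hq
      rw [overlay, overlay, ← hc]
      split_ifs with hpc
      · exact hv.2 p.row q.row (hpc ▸ p.inColumn) (hpc ▸ hc ▸ q.inColumn) hr
      · exact hg.2 p (mem_firstColumns.2 (by omega)) q (mem_firstColumns.2 (by omega)) hc hr

/-- The number `n` only has to be large enough: an empty column has the single filling `id`, of
weight `1`. -/
theorem tableauSum_firstColumns {n : ℕ} : ∀ {c : ℕ} {g : Box μ κ → Fin d} {u : Fin d → Fin d},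
    (∀ b : Box μ κ, b.col < c + n) → IsSemistandardOn (firstColumns μ κ c) g →
    (∀ b : Box μ κ, b.col + 1 = c → u b.row = g b) →
    tableauSum (firstColumns μ κ c) g = columnSum μ κ n c u := by
  induction n with
  | zero =>
    intro c g u hb hg _
    have : firstColumns μ κ c = univ := by
      ext b; simpa [mem_firstColumns] using hb b
    rw [this] at hg ⊢
    rw [tableauSum_univ, if_pos (isSemistandardOn_univ.1 hg), columnSum]
  | succ n ih =>
    intro c g u hb hg hu
    rw [columnSum, tableauSum_column Subset.rfl
      (fun b hb => mem_firstColumns.2 ((mem_firstColumns.1 hb).trans (Nat.lt_succ_self c))),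
      filter_true_of_mem, sum_filter]
    · refine sum_congr rfl fun v hv => ?_
      have hiff := isSemistandardOn_overlay_iff hv hg hu
      split_ifs with hle
      · rw [ih (u := v) (fun b => by have := hb b; omega) (hiff.2 hle), columnWeight_eq_prod]
        intro b hb
        rw [overlay, if_pos (by omega)]
      · rw [tableauSum_eq_zero (fun h => hle (hiff.1 h)), mul_zero]
    · intro v _ b hb hc
      rw [mem_firstColumns] at hb; omega

theorem Box.col_lt_sup (b : Box μ κ) : b.col < Finset.univ.sup μ :=
  (mem_boxes.1 b.2).2.trans_le (le_sup (f := μ) (mem_univ b.row))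

theorem isSwapInvariant_factorialSkewSchur {i j : Fin d} (hij : (j : ℕ) = i + 1)
    (hμ : Antitone μ) (hκ : Antitone κ) : IsSwapInvariant i j (factorialSkewSchur μ κ) := by
  have h0 : firstColumns μ κ 0 = ∅ := by ext b; simp [mem_firstColumns]
  -- Column number `0` has no boxes, so the initial filling `id` imposes no condition.
  rw [← tableauSum_empty (fun b : Box μ κ => b.row), ← h0,
    tableauSum_firstColumns (n := univ.sup μ) (u := id) (fun b => by
      rw [zero_add]; exact b.col_lt_sup) (by simp [IsSemistandardOn, h0]) (by simp)]
  refine isSwapInvariant_columnSum hij hμ hκ _ _ (fun r s hr => ?_) (fun h => ?_)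
  · exact absurd hr.1 (Nat.not_lt_zero _)
  · obtain ⟨r, hr, _⟩ := h
    exact absurd hr.1 (Nat.not_lt_zero _)

/-- If the last given entry, in reading order, is the letter `j = i + 1`, then the sum over the
remaining entries is invariant under the exchange of `i` and `j`. -/
theorem isSwapInvariant_tableauSum {i j : Fin d} (hij : (j : ℕ) = i + 1)
    (hμ : Antitone μ) (hκ : Antitone κ) {D : Finset (Box μ κ)} {a : Box μ κ}
    (hD : ∀ b, b ∈ D ↔ b.col < a.col ∨ b.col = a.col ∧ a.row ≤ b.row) {g : Box μ κ → Fin d}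
    (hg : g a = j) : IsSwapInvariant i j (tableauSum D g) := by
  have haD : a ∈ D := (hD a).2 (Or.inr ⟨rfl, le_rfl⟩)
  rw [tableauSum_column (c := a.col) (fun b hb => (hD b).2 (Or.inl (mem_firstColumns.1 hb)))
    (fun b hb => mem_firstColumns.2 (by have := (hD b).1 hb; omega))]
  refine isSwapInvariant_sum fun v hv => ?_
  rw [mem_filter] at hv
  have hva : v a.row = j := (hv.2 a haD rfl).trans hg
  have hvs := (mem_strictColumns.1 hv.1).2
  -- The unread boxes of the column of `a` lie below `a` and hold letters greater than `j`, so their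
  -- factors avoid both variables. The later columns follow a column containing `j`, as
  -- `isSwapInvariant_columnSum` requires.
  refine (isSwapInvariant_prod fun b hb => ?_).mul ?_
  · rw [mem_sdiff, mem_firstColumns, hD] at hb
    have hbc : b.col = a.col := by omega
    have hlt := hvs b.row a.row (hbc ▸ b.inColumn) a.inColumn (not_le.1 fun h => hb.2 (Or.inr ⟨hbc, h⟩))
    rw [hva, Fin.lt_def] at hlt
    exact isSwapInvariant_boxFactor (by rw [ne_eq, Fin.ext_iff]; omega)
      (by rw [ne_eq, Fin.ext_iff]; omega) _ _
  · by_cases hss : IsSemistandardOn (firstColumns μ κ (a.col + 1)) (overlay g a.col v)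
    · rw [tableauSum_firstColumns (n := univ.sup μ) (u := v) (fun b => by
        have := b.col_lt_sup; omega) hss (fun b hb => by rw [overlay, if_pos (by omega)])]
      exact isSwapInvariant_columnSum hij hμ hκ _ _ hvs fun _ => ⟨a.row, a.inColumn, hva⟩
    · rw [tableauSum_eq_zero hss]; exact isSwapInvariant_zero

end TableauSum
-- Alternants of factorial powers.
section Alternant
variable {d : ℕ}

/-- The factorial power `(x_a | y)^n`. -/
noncomputable def factorialPower (a : Fin d) (n : ℕ) : MvPolynomial (Fin d) YRing :=
  ∏ t ∈ range n, (X a - C (X ((t : ℤ) + 1)))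

theorem factorialPower_succ (a : Fin d) (n : ℕ) :
    factorialPower a (n + 1) = (X a - C (X ((n : ℤ) + 1))) * factorialPower a n := by
  rw [factorialPower, prod_range_succ, mul_comm]; rfl

/-- The signed sum, over the permutations `w`, of the images under `w` of
`(x_1 | y)^{m_1} ⋯ (x_d | y)^{m_d} p`. -/
noncomputable def alternant (m : Fin d → ℕ) (p : MvPolynomial (Fin d) YRing) :
    MvPolynomial (Fin d) YRing :=
  ∑ w : Equiv.Perm (Fin d), ((Equiv.Perm.sign w : ℤ) : MvPolynomial (Fin d) YRing) *
    (∏ i, factorialPower (w i) (m i)) * rename w p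

theorem alternant_zero (m : Fin d → ℕ) : alternant m 0 = 0 := by simp [alternant]

theorem alternant_sum {ι : Type*} (s : Finset ι) (m : Fin d → ℕ)
    (f : ι → MvPolynomial (Fin d) YRing) :
    alternant m (∑ a ∈ s, f a) = ∑ a ∈ s, alternant m (f a) := by
  simp only [alternant, map_sum, mul_sum]
  exact sum_comm

/-- Write `x_a - y = (x_a - y_{m_a+1}) + (y_{m_a+1} - y)`. The first summand is the next factor of
the factorial power, and the second is fixed by permutations of the `x`'s. -/
theorem alternant_linear_mul (m : Fin d → ℕ) (a : Fin d) (y : YRing)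
    (p : MvPolynomial (Fin d) YRing) :
    alternant m ((X a - C y) * p) =
      alternant (Function.update m a (m a + 1)) p + C (X ((m a : ℤ) + 1) - y) * alternant m p := by
  simp only [alternant, mul_sum, ← sum_add_distrib]
  refine sum_congr rfl fun w _ => ?_
  have h : ∏ i, factorialPower (w i) (Function.update m a (m a + 1) i) =
      (X (w a) - C (X ((m a : ℤ) + 1))) * ∏ i, factorialPower (w i) (m i) := by
    rw [← mul_prod_erase univ _ (mem_univ a), ← mul_prod_erase univ _ (mem_univ a),
      Function.update_self, factorialPower_succ, mul_assoc]
    congr 2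
    refine prod_congr rfl fun i hi => ?_
    rw [Function.update_of_ne (ne_of_mem_erase hi)]
  rw [h, map_mul, map_sub, rename_X, rename_C, map_sub]
  ring

/-- Replacing `w` by `w * swap i j` reverses the sign and changes nothing else, so the alternant is
its own negative. -/
theorem alternant_eq_zero {m : Fin d → ℕ} {i j : Fin d} (hij : i ≠ j) (hm : m i = m j)
    {p : MvPolynomial (Fin d) YRing} (hp : IsSwapInvariant i j p) : alternant m p = 0 := by
  have h : alternant m p = -alternant m p := by
    conv_lhs => rw [alternant, ← Equiv.sum_comp (Equiv.mulRight (Equiv.swap i j))]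
    rw [alternant, ← sum_neg_distrib]
    refine sum_congr rfl fun w _ => ?_
    rw [Equiv.coe_mulRight, Equiv.Perm.sign_mul, Equiv.Perm.sign_swap hij, Equiv.Perm.coe_mul,
      ← rename_rename, hp, ← Equiv.prod_comp (Equiv.swap i j)]
    have hm' : ∀ k, m (Equiv.swap i j k) = m k := by
      intro k
      by_cases h1 : k = i
      · rw [h1, Equiv.swap_apply_left, hm]
      · by_cases h2 : k = j
        · rw [h2, Equiv.swap_apply_right, hm]
        · rw [Equiv.swap_apply_of_ne_of_ne h1 h2]
    simp only [hm', Equiv.swap_apply_self, mul_neg, mul_one, Units.val_neg, Int.cast_neg,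
      Function.comp_apply]
    ring
  exact self_eq_neg.1 h

theorem alternant_eq_mul {p : MvPolynomial (Fin d) YRing}
    (hp : ∀ w : Equiv.Perm (Fin d), rename w p = p) (m : Fin d → ℕ) :
    alternant m p = alternant m 1 * p := by
  rw [alternant, alternant, sum_mul]
  refine sum_congr rfl fun w _ => ?_
  rw [hp, map_one, mul_one]

theorem rename_eq_of_isSwapInvariant {d : ℕ} {p : MvPolynomial (Fin d) YRing}
    (hp : ∀ i j : Fin d, (j : ℕ) = i + 1 → IsSwapInvariant i j p) (w : Equiv.Perm (Fin d)) :
    rename w p = p := by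
  rcases d with _ | n
  · rw [Subsingleton.elim w 1, Equiv.Perm.coe_one, rename_id_apply]
  · have hw : w ∈ Submonoid.closure
        (Set.range fun i : Fin n => Equiv.swap i.castSucc i.succ) := by
      rw [Equiv.Perm.mclosure_swap_castSucc_succ]; trivial
    induction hw using Submonoid.closure_induction with
    | mem x hx =>
      obtain ⟨i, rfl⟩ := hx
      exact hp _ _ (by simp)
    | one => rw [Equiv.Perm.coe_one, rename_id_apply]
    | mul x y _ _ hx hy => rw [Equiv.Perm.coe_mul, ← rename_rename, hy, hx]

/-- The exponents `(d - 1, d - 2, …, 0)`. -/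
def staircase (d : ℕ) : Fin d → ℕ := fun i => d - 1 - i

/-- Up to the order of its columns, this is the determinant of monic polynomials of degrees `0, …, d
- 1` evaluated at the variables, which is the Vandermonde determinant. The staircase decreases,
hence the reversal `Fin.revPerm`. -/
theorem alternant_staircase_ne_zero : alternant (staircase d) 1 ≠ 0 := by
  let P : Fin d → Polynomial (MvPolynomial (Fin d) YRing) := fun j =>
    ∏ t ∈ range j, (Polynomial.X - Polynomial.C (C (X ((t : ℤ) + 1))))
  have hdet := Matrix.det_eval_matrixOfPolynomials_eq_det_vandermonde
    (fun i : Fin d => (X i : MvPolynomial (Fin d) YRing)) P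
    (fun i => by
      rw [Polynomial.natDegree_prod_of_monic _ _ fun t _ => Polynomial.monic_X_sub_C _]
      simp only [Polynomial.natDegree_X_sub_C, sum_const, card_range, smul_eq_mul, mul_one])
    (fun i => Polynomial.monic_prod_of_monic _ _ fun t _ => Polynomial.monic_X_sub_C _)
  have hne := Matrix.det_vandermonde_ne_zero_iff.2
    (X_injective : Function.Injective (X : Fin d → MvPolynomial (Fin d) YRing))
  rw [hdet] at hne
  intro h
  apply hne
  have hperm := Matrix.det_permute' Fin.revPerm (Matrix.of fun i j : Fin d =>
    (P j).eval (X i : MvPolynomial (Fin d) YRing))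
  have h0 : (Matrix.submatrix (Matrix.of fun i j : Fin d =>
      (P j).eval (X i : MvPolynomial (Fin d) YRing)) id Fin.revPerm).det = 0 := by
    rw [Matrix.det_apply', ← h, alternant]
    refine sum_congr rfl fun w _ => ?_
    rw [map_one, mul_one]
    congr 1
    refine prod_congr rfl fun i _ => ?_
    simp only [Matrix.submatrix_apply, id, Matrix.of_apply, P, Polynomial.eval_prod,
      Polynomial.eval_sub, Polynomial.eval_X, Polynomial.eval_C, factorialPower, staircase,
      Fin.revPerm_apply, Fin.val_rev]
    rw [Nat.sub_sub, add_comm]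
  rw [h0] at hperm
  rcases Int.units_eq_one_or (Equiv.Perm.sign (Fin.revPerm : Equiv.Perm (Fin d))) with hs | hs <;>
    rw [hs] at hperm <;> simpa using hperm.symm

end Alternant
-- Yamanouchi words and their contents.
section Words
variable {d : ℕ}

theorem isYamanouchi_iff {w : List (Fin d)} : IsYamanouchi w ↔
    ∀ u, u <+: w → ∀ i j : Fin d, (j : ℕ) = i + 1 → u.count j ≤ u.count i := by
  simp [IsYamanouchi, List.mem_inits]

theorem IsYamanouchi.of_prefix {u w : List (Fin d)} (hw : IsYamanouchi w) (h : u <+: w) :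
    IsYamanouchi u := by
  rw [isYamanouchi_iff] at *
  exact fun v hv => hw v (hv.trans h)

theorem isYamanouchi_nil : IsYamanouchi ([] : List (Fin d)) := by simp [IsYamanouchi]

theorem IsYamanouchi.append {u w : List (Fin d)} (hu : IsYamanouchi u) (hw : IsYamanouchi w) :
    IsYamanouchi (u ++ w) := by
  rw [isYamanouchi_iff] at *
  intro v hv i j hij
  rcases List.prefix_or_prefix_of_prefix hv (List.prefix_append u w) with h | ⟨t, rfl⟩
  · exact hu v h i j hij
  · rw [List.count_append, List.count_append]
    exact add_le_add (hu u List.prefix_rfl i j hij)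
      (hw t ((List.prefix_append_right_inj u).1 hv) i j hij)

theorem isYamanouchi_concat {w : List (Fin d)} {k : Fin d} :
    IsYamanouchi (w ++ [k]) ↔
      IsYamanouchi w ∧ ∀ i : Fin d, (k : ℕ) = i + 1 → w.count k + 1 ≤ w.count i := by
  constructor
  · intro h
    refine ⟨h.of_prefix (List.prefix_append _ _), fun i hi => ?_⟩
    have := isYamanouchi_iff.1 h _ List.prefix_rfl i k hi
    have hne : i ≠ k := by rw [ne_eq, Fin.ext_iff]; omega
    simpa [List.count_append, List.count_singleton, hne.symm] using this
  · rintro ⟨hw, h⟩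
    rw [isYamanouchi_iff] at *
    intro u hu i j hij
    rcases List.prefix_concat_iff.1 hu with rfl | hu
    · have h0 := hw w List.prefix_rfl i j hij
      rw [List.count_append, List.count_append, List.count_singleton, List.count_singleton]
      by_cases hk : k = j
      · subst hk
        have := h i hij
        simp only [beq_self_eq_true, if_true]; omega
      · simp only [beq_iff_eq, hk, if_false]; omega
    · exact hw u hu i j hij

theorem content_append (u w : List (Fin d)) : content (u ++ w) = content u + content w := by
  funext k; simp [content]

theorem content_youngWord (lam : Fin d → ℕ) : content (youngWord lam) = lam := by
  funext k
  have h : ∀ c, ((List.finRange d).filter fun r => decide (c < lam r)).count k =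
      if c < lam k then 1 else 0 := by
    intro c
    split_ifs with hc
    · exact List.count_eq_one_of_mem ((List.nodup_finRange d).filter _) (by simp [hc])
    · exact List.count_eq_zero_of_not_mem (by simp [hc])
  have hle : lam k ≤ univ.sup lam := le_sup (mem_univ k)
  rw [content, youngWord, List.count_flatMap]
  simp only [Function.comp_def, h]
  rw [List.map_reverse, List.sum_reverse]
  have hsum : ∀ n, ((List.range n).map fun c => if c < lam k then 1 else 0).sum =
      min n (lam k) := by
    intro n
    induction n with
    | zero => simp
    | succ n ih =>
      rw [List.range_succ, List.map_append, List.sum_append, ih, List.map_singleton,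
        List.sum_singleton]
      split_ifs <;> omega
  rw [hsum, min_eq_right hle]

/-- Since `lam` is antitone, each column reads `1, 2, …` without gaps and is itself Yamanouchi; the
property survives concatenation. -/
theorem isYamanouchi_youngWord {lam : Fin d → ℕ} (hlam : Antitone lam) :
    IsYamanouchi (youngWord lam) := by
  unfold youngWord
  generalize (List.range (univ.sup lam)).reverse = l
  induction l with
  | nil => exact isYamanouchi_nil
  | cons c l ih =>
    rw [List.flatMap_cons]
    refine IsYamanouchi.append ?_ ih
    rw [isYamanouchi_iff]
    rintro u ⟨t, ht⟩ i j hij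
    have hsort : ((List.finRange d).filter fun r => decide (c < lam r)).Pairwise (· < ·) :=
      (List.pairwise_lt_finRange d).filter _
    by_cases hj : j ∈ u
    · have hi : i ∈ u := by
        have hj' : j ∈ u ++ t := List.mem_append_left _ hj
        have hlt : i < j := by rw [Fin.lt_def]; omega
        rw [ht, List.mem_filter, decide_eq_true_eq] at hj'
        have hi' : i ∈ u ++ t := by
          rw [ht, List.mem_filter, decide_eq_true_eq]
          exact ⟨List.mem_finRange i, hj'.2.trans_le (hlam hlt.le)⟩
        rcases List.mem_append.1 hi' with h | h
        · exact h
        · rw [← ht] at hsort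
          exact absurd ((List.pairwise_append.1 hsort).2.2 j hj i h) hlt.asymm
      have hnd : u.Nodup := by
        have := (hsort.imp fun h => ne_of_lt h)
        rw [← ht] at this
        exact (List.pairwise_append.1 this).1
      rw [List.count_eq_one_of_mem hnd hj, List.count_eq_one_of_mem hnd hi]
    · rw [List.count_eq_zero_of_not_mem hj]; exact Nat.zero_le _

end Words

/-! ### The expansion of an alternant along the reading order. -/

section ReadingOrder
variable {d : ℕ} {μ κ : Fin d → ℕ}

/-- The box `p` is read before the box `q`. -/
def Box.Before (p q : Box μ κ) : Prop := p.col < q.col ∨ p.col = q.col ∧ q.row < p.row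

instance (p q : Box μ κ) : Decidable (p.Before q) := inferInstanceAs (Decidable (_ ∨ _))

theorem Box.Before.asymm {p q : Box μ κ} (h : p.Before q) : ¬ q.Before p := by
  unfold Box.Before at *
  simp only [Fin.lt_def] at *; omega

theorem Box.Before.ne {p q : Box μ κ} (h : p.Before q) : p ≠ q := by
  rintro rfl; exact h.asymm h

theorem mem_readingOrder (b : Box μ κ) : b ∈ readingOrder μ κ := by
  simp only [readingOrder, List.mem_flatMap, List.mem_range, List.mem_filterMap, List.mem_reverse]
  exact ⟨b.col, b.col_lt_sup, b.row, List.mem_finRange _, by rw [dif_pos b.2]⟩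

theorem pairwise_readingOrder : (readingOrder μ κ).Pairwise Box.Before := by
  have hcol : ∀ {c : ℕ} {r : Fin d} {b : Box μ κ},
      (if h : (r, c) ∈ boxes μ κ then some (⟨(r, c), h⟩ : Box μ κ) else none) = some b →
      b.row = r ∧ b.col = c := by
    intro c r b h
    split_ifs at h with h'
    rw [Option.some_inj] at h
    subst h; exact ⟨rfl, rfl⟩
  rw [readingOrder, List.pairwise_flatMap]
  refine ⟨fun c _ => ?_, ?_⟩
  · rw [List.pairwise_filterMap, List.pairwise_reverse]
    refine (List.pairwise_lt_finRange d).imp fun {r s} hrs p hp q hq => ?_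
    obtain ⟨hp1, hp2⟩ := hcol hp
    obtain ⟨hq1, hq2⟩ := hcol hq
    exact Or.inr ⟨by rw [hp2, hq2], by rwa [hp1, hq1]⟩
  · refine List.pairwise_lt_range.imp fun {c e} hce p hp q hq => ?_
    rw [List.mem_filterMap] at hp hq
    obtain ⟨r, _, hp⟩ := hp
    obtain ⟨s, _, hq⟩ := hq
    exact Or.inl (by rwa [(hcol hp).2, (hcol hq).2])

theorem mem_pre_iff {pre l : List (Box μ κ)} {a : Box μ κ}
    (h : readingOrder μ κ = pre ++ a :: l) {q : Box μ κ} : q ∈ pre ↔ q.Before a := by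
  have hp := pairwise_readingOrder (μ := μ) (κ := κ)
  rw [h, List.pairwise_append] at hp
  refine ⟨fun hq => hp.2.2 q hq a List.mem_cons_self, fun hq => ?_⟩
  have hm := mem_readingOrder q
  rw [h, List.mem_append, List.mem_cons] at hm
  rcases hm with hm | rfl | hm
  · exact hm
  · exact absurd rfl hq.ne
  · exact absurd ((List.pairwise_cons.1 hp.2.1).1 q hm) hq.asymm

theorem takeWhile_readingOrder {pre l : List (Box μ κ)} {a : Box μ κ}
    (h : readingOrder μ κ = pre ++ a :: l) :
    (readingOrder μ κ).takeWhile (fun b => b ≠ a) = pre := by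
  rw [h, List.takeWhile_append_of_pos, List.takeWhile_cons_of_neg, List.append_nil]
  · simp
  · intro q hq
    simpa using ((mem_pre_iff h).1 hq).ne

theorem unbarredEntries_append (B : Box μ κ → Fin d × Bool) (l l' : List (Box μ κ)) :
    unbarredEntries B (l ++ l') = unbarredEntries B l ++ unbarredEntries B l' := by
  rw [unbarredEntries, List.filterMap_append]; rfl

theorem unbarredEntries_congr {B B' : Box μ κ → Fin d × Bool} {l : List (Box μ κ)}
    (h : ∀ b ∈ l, B b = B' b) : unbarredEntries B l = unbarredEntries B' l :=
  List.filterMap_congr fun b hb => by rw [h b hb]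

/-- The factor of `coeffStar` coming from a barred entry. -/
noncomputable def barFactor (lam : Fin d → ℕ) (B : Box μ κ → Fin d × Bool) (a : Box μ κ) : YRing :=
  X (((d : ℤ) - ((B a).1 : ℕ)) + (content (starWordBefore lam B a) (B a).1 : ℤ))
    - X (shiftIndex (B a).1 a)

/-- Here `pre` is the part already read, filled by `g`, and `l` the part still to be read. The
exponent vector keeps track of the unbarred letters met so far, so that each step is one application
of `alternant_linear_mul`. -/
theorem alternant_tableauSum {lam : Fin d → ℕ} (hμ : Antitone μ) (hκ : Antitone κ) :
    ∀ (l pre : List (Box μ κ)), readingOrder μ κ = pre ++ l → ∀ g : Box μ κ → Fin d × Bool,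
    IsYamanouchi (youngWord lam ++ unbarredEntries g pre) →
    alternant (lam + staircase d + content (unbarredEntries g pre))
        (tableauSum pre.toFinset fun b => (g b).1) =
      ∑ B ∈ reverseBarredTableaux μ κ with
          (∀ q ∈ pre, B q = g q) ∧ IsYamanouchi (starWord lam B),
        C (∏ a ∈ l.toFinset with (B a).2 = true, barFactor lam B a) *
          alternant (lam + staircase d + content (unbarredWord B)) 1 := by
  intro l
  induction l with
  | nil =>
    intro pre hpre g hg
    rw [List.append_nil] at hpre
    subst hpre
    have huniv : (readingOrder μ κ).toFinset = univ := by
      ext b; simp [mem_readingOrder]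
    have hiff : ∀ B : Box μ κ → Fin d × Bool,
        ((∀ q ∈ readingOrder μ κ, B q = g q) ∧ IsYamanouchi (starWord lam B)) ↔ B = g := by
      refine fun B => ⟨fun h => funext fun q => h.1 q (mem_readingOrder q), ?_⟩
      rintro rfl
      exact ⟨fun _ _ => rfl, hg⟩
    simp only [hiff, huniv, tableauSum_univ, filter_eq', reverseBarredTableaux, mem_filter,
      mem_univ, true_and]
    split_ifs with hs
    · simp [unbarredWord]
    · simp [alternant_zero]
  | cons b l ih =>
    intro pre hpre g hg
    have hpre' : readingOrder μ κ = (pre ++ [b]) ++ l := by rw [hpre]; simp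
    have hmem : ∀ {q}, q ∈ pre ↔ q.Before b := mem_pre_iff hpre
    have hb : b ∉ pre := fun h => (hmem.1 h).ne rfl
    have hbl : b ∉ l := by
      have hp := pairwise_readingOrder (μ := μ) (κ := κ)
      rw [hpre, List.pairwise_append] at hp
      exact fun h => ((List.pairwise_cons.1 hp.2.1).1 b h).ne rfl
    have htf : (pre ++ [b]).toFinset = insert b pre.toFinset := by
      ext q; simp
    have hagree : ∀ (B : Box μ κ → Fin d × Bool) v,
        (∀ q ∈ pre ++ [b], B q = Function.update g b v q) ↔ (∀ q ∈ pre, B q = g q) ∧ B b = v := by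
      intro B v
      rw [List.forall_mem_append, List.forall_mem_singleton, Function.update_self]
      refine and_congr_left' (forall₂_congr fun q hq => ?_)
      rw [Function.update_of_ne (ne_of_mem_of_not_mem hq hb)]
    have hupd : ∀ v, unbarredEntries (Function.update g b v) pre = unbarredEntries g pre :=
      fun v => unbarredEntries_congr fun q hq =>
        Function.update_of_ne (ne_of_mem_of_not_mem hq hb) _ _
    have hfst : ∀ v : Fin d × Bool, (fun q => (Function.update g b v q).1) =
        Function.update (fun q => (g q).1) b v.1 := by
      intro v; funext q
      by_cases hq : q = b
      · subst hq; simp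
      · simp [hq]
    have hbarred : ∀ k, unbarredEntries (Function.update g b (k, true)) (pre ++ [b]) =
        unbarredEntries g pre := by
      intro k; rw [unbarredEntries_append, hupd]; simp [unbarredEntries]
    have hunbarred : ∀ k, unbarredEntries (Function.update g b (k, false)) (pre ++ [b]) =
        unbarredEntries g pre ++ [k] := by
      intro k; rw [unbarredEntries_append, hupd]; simp [unbarredEntries]
    have hD : ∀ q, q ∈ (pre ++ [b]).toFinset ↔
        q.col < b.col ∨ q.col = b.col ∧ b.row ≤ q.row := by
      intro q
      rw [List.mem_toFinset, List.mem_append, List.mem_singleton, hmem, Box.Before]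
      constructor
      · rintro ((h | h) | rfl)
        · exact Or.inl h
        · exact Or.inr ⟨h.1, h.2.le⟩
        · exact Or.inr ⟨rfl, le_rfl⟩
      · rintro (h | ⟨h, h'⟩)
        · exact Or.inl (Or.inl h)
        · rcases h'.lt_or_eq with h' | h'
          · exact Or.inl (Or.inr ⟨h, h'⟩)
          · exact Or.inr (Box.ext' h'.symm h)
    rw [tableauSum_insert (by rwa [List.mem_toFinset]), alternant_sum,
      ← sum_fiberwise _ (fun B : Box μ κ → Fin d × Bool => B b), Fintype.sum_prod_type]
    refine sum_congr rfl fun k _ => ?_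
    rw [Fintype.sum_bool, boxFactor, alternant_linear_mul, add_comm]
    simp only [filter_filter]
    congr 1
    · have h := ih (pre ++ [b]) hpre' (Function.update g b (k, true)) (by rwa [hbarred])
      rw [hbarred, hfst, htf] at h
      rw [h, mul_sum]
      refine sum_congr ?_ fun B hB => ?_
      · refine filter_congr fun B _ => ?_
        rw [hagree]; tauto
      · rw [mem_filter] at hB
        have hBb := hB.2.2
        rw [List.toFinset_cons, filter_insert, if_pos (by rw [hBb]), prod_insert (by simp [hbl]),
          C_mul, ← mul_assoc]
        congr 3
        rw [barFactor, starWordBefore, takeWhile_readingOrder hpre,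
          unbarredEntries_congr hB.2.1.1, hBb, content_append,
          content_youngWord, shiftIndex]
        -- With `k` counted from zero, `m_k + 1 = λ_k + (d - 1 - k) + ω_k + 1 = (d - k) + (λ_k +
        -- ω_k)`, the first index in `barFactor`.
        simp only [Pi.add_apply, staircase]
        congr 2
        have := k.2
        push_cast [Nat.sub_sub, Nat.cast_sub (show 1 + (k : ℕ) ≤ d by omega)]
        ring
    · have hset : ∀ B : Box μ κ → Fin d × Bool,
          (((∀ q ∈ pre, B q = g q) ∧ IsYamanouchi (starWord lam B)) ∧ B b = (k, false)) ↔
          (∀ q ∈ pre ++ [b], B q = Function.update g b (k, false) q) ∧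
            IsYamanouchi (starWord lam B) := by
        intro B; rw [hagree]; tauto
      have hm : Function.update (lam + staircase d + content (unbarredEntries g pre)) k
          ((lam + staircase d + content (unbarredEntries g pre)) k + 1) =
          lam + staircase d + content (unbarredEntries g pre ++ [k]) := by
        funext i
        by_cases hi : i = k
        · subst hi; simp [content, add_assoc]
        · simp [content, hi, Ne.symm hi]
      simp only [hset]
      rw [hm]
      by_cases hY : IsYamanouchi (youngWord lam ++ (unbarredEntries g pre ++ [k]))
      · have h := ih (pre ++ [b]) hpre' (Function.update g b (k, false)) (by rwa [hunbarred])
        rw [hunbarred, hfst, htf] at h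
        rw [h]
        refine sum_congr rfl fun B hB => ?_
        rw [mem_filter] at hB
        have hBb := ((hagree _ _).1 hB.2.1).2
        rw [List.toFinset_cons, filter_insert, if_neg (by rw [hBb]; simp)]
      · rw [filter_false_of_mem, sum_empty]
        · rw [← List.append_assoc, isYamanouchi_concat] at hY
          push Not at hY
          obtain ⟨i, hi, hlt⟩ := hY hg
          have hle := isYamanouchi_iff.1 hg _ List.prefix_rfl i k hi
          have hne : i ≠ k := by rw [ne_eq, Fin.ext_iff]; omega
          -- The word was Yamanouchi before `k = i + 1` was appended, so it had equally many letters
          -- `i` and `k`. The exponents then differed by one, through the staircase, and the new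
          -- letter makes them equal.
          refine alternant_eq_zero hne ?_ ?_ (i := i) (j := k)
          · have h1 := congrFun (content_youngWord lam) i
            have h2 := congrFun (content_youngWord lam) k
            simp only [content] at h1 h2
            rw [List.count_append, List.count_append, h1, h2] at hle hlt
            simp only [Pi.add_apply, staircase, content, List.count_append, List.count_singleton,
              beq_self_eq_true, if_true, beq_iff_eq, Ne.symm hne, if_false]
            have := k.2
            omega
          · rw [← htf]
            exact isSwapInvariant_tableauSum hi hμ hκ hD (Function.update_self _ _ _)
        · rintro B _ ⟨hB, hB'⟩
          refine hY (hB'.of_prefix ?_)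
          rw [← hunbarred, ← unbarredEntries_congr hB, starWord, unbarredWord, hpre',
            unbarredEntries_append _ (pre ++ [b])]
          rw [← List.append_assoc]
          exact List.prefix_append _ _

/-- This is `alternant_tableauSum` with nothing read yet; the symmetry of the skew polynomial lets
it leave the alternant. -/
theorem alternant_mul_factorialSkewSchur {lam : Fin d → ℕ} (hlam : Antitone lam)
    (hμ : Antitone μ) (hκ : Antitone κ) :
    alternant (lam + staircase d) 1 * factorialSkewSchur μ κ =
      ∑ B ∈ reverseBarredTableaux μ κ with IsYamanouchi (starWord lam B),
        C (coeffStar lam B) * alternant (lam + content (unbarredWord B) + staircase d) 1 := by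
  rw [← alternant_eq_mul (rename_eq_of_isSwapInvariant fun i j hij =>
    isSwapInvariant_factorialSkewSchur hij hμ hκ)]
  have h := alternant_tableauSum (lam := lam) hμ hκ (readingOrder μ κ) [] rfl
    (fun b => (b.row, false)) (by simpa [unbarredEntries] using isYamanouchi_youngWord hlam)
  have huniv : (readingOrder μ κ).toFinset = univ := by
    ext b; simp [mem_readingOrder]
  rw [List.toFinset_nil, tableauSum_empty, huniv] at h
  simp only [List.not_mem_nil, false_imp_iff, implies_true, true_and] at h
  have h0 : content (unbarredEntries (fun b : Box μ κ => (b.row, false)) []) = 0 := by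
    funext k; simp [content, unbarredEntries]
  rw [h0, add_zero] at h
  rw [h]
  refine sum_congr rfl fun B _ => ?_
  rw [add_right_comm]; rfl

end ReadingOrder
-- Letter counts of words as numbers of boxes.
section Counting
variable {d : ℕ} {μ κ : Fin d → ℕ}

theorem content_unbarredEntries (B : Box μ κ → Fin d × Bool) {l : List (Box μ κ)} (hl : l.Nodup)
    (k : Fin d) :
    content (unbarredEntries B l) k = (univ.filter fun q => q ∈ l ∧ B q = (k, false)).card := by
  have h : (univ.filter fun q => q ∈ l ∧ B q = (k, false)) =
      (l.filter fun q => decide (B q = (k, false))).toFinset := by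
    ext q; simp
  rw [h, List.toFinset_card_of_nodup (hl.filter _), ← List.countP_eq_length_filter, content,
    unbarredEntries, List.count_filterMap]
  refine List.countP_congr fun q _ => ?_
  rcases hq : B q with ⟨a, s⟩
  cases s <;> simp

theorem nodup_readingOrder : (readingOrder μ κ).Nodup :=
  pairwise_readingOrder.imp fun h => h.ne

theorem exists_readingOrder_eq (a : Box μ κ) : ∃ pre l, readingOrder μ κ = pre ++ a :: l :=
  List.append_of_mem (mem_readingOrder a)

theorem content_starWordBefore (lam : Fin d → ℕ) (B : Box μ κ → Fin d × Bool) (a : Box μ κ)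
    (k : Fin d) : content (starWordBefore lam B a) k =
      lam k + (univ.filter fun q => q.Before a ∧ B q = (k, false)).card := by
  obtain ⟨pre, l, h⟩ := exists_readingOrder_eq a
  have hnd := nodup_readingOrder (μ := μ) (κ := κ)
  rw [h] at hnd
  rw [starWordBefore, takeWhile_readingOrder h, content_append, content_youngWord, Pi.add_apply,
    content_unbarredEntries B (List.Nodup.of_append_left hnd)]
  simp only [mem_pre_iff h]

theorem content_unbarredWord (B : Box μ κ → Fin d × Bool) (k : Fin d) :
    content (unbarredWord B) k = (univ.filter fun q => B q = (k, false)).card := by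
  rw [unbarredWord, content_unbarredEntries B nodup_readingOrder]
  simp only [mem_readingOrder, true_and]

theorem youngWord_zero : youngWord (0 : Fin d → ℕ) = [] := by
  have : (univ.sup (0 : Fin d → ℕ)) = 0 := by
    rw [← Nat.le_zero]; exact Finset.sup_le fun _ _ => le_rfl
  rw [youngWord, this]; rfl

theorem IsYamanouchi.card_le {B : Box μ κ → Fin d × Bool}
    (hB : IsYamanouchi (starWord 0 B)) (a : Box μ κ) {i j : Fin d} (hij : (j : ℕ) = i + 1) :
    (univ.filter fun q => (q.Before a ∨ q = a) ∧ B q = (j, false)).card ≤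
      (univ.filter fun q => (q.Before a ∨ q = a) ∧ B q = (i, false)).card := by
  obtain ⟨pre, l, h⟩ := exists_readingOrder_eq a
  have h' : readingOrder μ κ = (pre ++ [a]) ++ l := by rw [h]; simp
  have hnd := nodup_readingOrder (μ := μ) (κ := κ)
  rw [h'] at hnd
  have hmem : ∀ q, q ∈ pre ++ [a] ↔ q.Before a ∨ q = a := by
    intro q; rw [List.mem_append, List.mem_singleton, mem_pre_iff h]
  have key := isYamanouchi_iff.1 hB (unbarredEntries B (pre ++ [a])) (by
    rw [starWord, youngWord_zero, List.nil_append, unbarredWord, h',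
      unbarredEntries_append B (pre ++ [a]) l]
    exact List.prefix_append _ _) i j hij
  have h1 := fun k => content_unbarredEntries B (List.Nodup.of_append_left hnd) k
  simp only [content, hmem] at h1
  rwa [h1, h1] at key

theorem isYamanouchi_starWord_zero {B : Box μ κ → Fin d × Bool}
    (hB : ∀ (a : Box μ κ) (i j : Fin d), (j : ℕ) = i + 1 → B a = (j, false) →
      (univ.filter fun q => (q.Before a ∨ q = a) ∧ B q = (j, false)).card ≤
        (univ.filter fun q => q.Before a ∧ B q = (i, false)).card) :
    IsYamanouchi (starWord 0 B) := by
  rw [starWord, youngWord_zero, List.nil_append, unbarredWord]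
  suffices h : ∀ pre l, readingOrder μ κ = pre ++ l → IsYamanouchi (unbarredEntries B pre) from
    h _ [] (List.append_nil _).symm
  intro pre
  induction pre using List.reverseRecOn with
  | nil => intro l _; exact isYamanouchi_nil
  | append_singleton pre a ih =>
    intro l h'
    have h : readingOrder μ κ = pre ++ a :: l := by rw [h']; simp
    have hpre := ih _ h
    rw [unbarredEntries_append]
    rcases ha : B a with ⟨k, s⟩
    cases s with
    | true => simpa [unbarredEntries, ha] using hpre
    | false =>
      have hk : unbarredEntries B [a] = [k] := by simp [unbarredEntries, ha]
      rw [hk, isYamanouchi_concat]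
      refine ⟨hpre, fun i hi => ?_⟩
      have hnd := nodup_readingOrder (μ := μ) (κ := κ)
      rw [h] at hnd
      have h1 := fun k => content_unbarredEntries B (List.Nodup.of_append_left hnd) k
      simp only [content, mem_pre_iff h] at h1
      rw [h1, h1]
      refine le_trans (le_of_eq ?_) (hB a i k hi ha)
      rw [← card_insert_of_notMem (a := a) (by simpa using fun h => absurd rfl h.ne)]
      congr 1
      ext q
      simp only [mem_insert, mem_filter, mem_univ, true_and]
      constructor
      · rintro (rfl | h)
        · exact ⟨Or.inr rfl, ha⟩
        · exact ⟨Or.inl h.1, h.2⟩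
      · rintro ⟨h | h, h'⟩
        · exact Or.inr ⟨h, h'⟩
        · exact Or.inl h

end Counting

/-! ### The case `λ = 0`, the bialternant formula and the conclusion. -/

section Canonical
variable {d : ℕ} {μ : Fin d → ℕ}

/-- The number of boxes in a column of `μ`. -/
def height (μ : Fin d → ℕ) (c : ℕ) : ℕ := (univ.filter fun r => c < μ r).card

theorem lt_height_iff (hμ : Antitone μ) {c : ℕ} {r : Fin d} : (r : ℕ) < height μ c ↔ c < μ r := by
  constructor
  · intro h
    by_contra hc
    have hsub : (univ.filter fun r => c < μ r) ⊆ Iio r := by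
      intro s hs
      rw [mem_filter] at hs
      rw [mem_Iio]
      by_contra hrs
      exact hc (hs.2.trans_le (hμ (not_lt.1 hrs)))
    have := card_le_card hsub
    rw [Fin.card_Iio] at this
    exact absurd h (not_lt.2 this)
  · intro h
    have hsub : Iic r ⊆ univ.filter fun r => c < μ r := by
      intro s hs
      rw [mem_Iic] at hs
      rw [mem_filter]
      exact ⟨mem_univ s, h.trans_le (hμ hs)⟩
    have := card_le_card hsub
    rw [Fin.card_Iic] at this
    exact this

theorem height_le (μ : Fin d → ℕ) (c : ℕ) : height μ c ≤ d :=
  (card_filter_le _ _).trans (by simp)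

theorem height_antitone (μ : Fin d → ℕ) : Antitone (height μ) := fun c e h =>
  card_le_card fun r hr => by
    rw [mem_filter] at *
    exact ⟨hr.1, h.trans_lt hr.2⟩

theorem Box.row_lt_height (hμ : Antitone μ) (b : Box μ 0) : (b.row : ℕ) < height μ b.col :=
  (lt_height_iff hμ).2 (mem_boxes.1 b.2).2

/-- The box of `μ` in a given row and column. -/
def boxOf {r : Fin d} {c : ℕ} (h : c < μ r) : Box μ 0 := ⟨(r, c), mem_boxes.2 ⟨Nat.zero_le _, h⟩⟩

/-- The unbarred tableau of shape `μ` whose columns read `1, 2, …` from top to bottom. -/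
def canonicalTableau (μ : Fin d → ℕ) : Box μ 0 → Fin d × Bool := fun b =>
  (⟨height μ b.col - 1 - b.row, by have := height_le μ b.col; have := b.row.2; omega⟩, false)

theorem canonicalTableau_eq_iff (hμ : Antitone μ) {b : Box μ 0} {t : Fin d} :
    canonicalTableau μ b = (t, false) ↔ (t : ℕ) + b.row + 1 = height μ b.col := by
  have := b.row_lt_height hμ
  simp only [canonicalTableau, Prod.mk.injEq, Fin.ext_iff, and_true]
  omega

theorem card_canonicalTableau (hμ : Antitone μ) {c : ℕ} {t : Fin d}
    (h : ∀ e < c, (t : ℕ) < height μ e) :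
    (univ.filter fun q => q.col < c ∧ canonicalTableau μ q = (t, false)).card = c := by
  conv_rhs => rw [← card_range c]
  refine card_bij (fun q _ => q.col) ?_ ?_ ?_
  · intro q hq
    rw [mem_filter] at hq
    exact mem_range.2 hq.2.1
  · intro p hp q hq hpq
    rw [mem_filter, canonicalTableau_eq_iff hμ] at hp hq
    refine Box.ext' (Fin.ext ?_) hpq
    have h1 := hp.2.2
    have h2 := hq.2.2
    simp only [hpq] at h1
    omega
  · intro e he
    have he' := h e (mem_range.1 he)
    have hd := height_le μ e
    let r : Fin d := ⟨height μ e - 1 - t, by omega⟩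
    have hr : e < μ r := (lt_height_iff hμ).1 (by simp only [r]; omega)
    refine ⟨boxOf hr, ?_, rfl⟩
    rw [mem_filter, canonicalTableau_eq_iff hμ]
    refine ⟨mem_univ _, mem_range.1 he, ?_⟩
    change (t : ℕ) + (height μ e - 1 - t) + 1 = height μ e
    omega

theorem content_canonicalTableau (hμ : Antitone μ) :
    content (unbarredWord (canonicalTableau μ)) = μ := by
  funext t
  rw [content_unbarredWord]
  conv_rhs => rw [← card_canonicalTableau hμ (c := μ t) (t := t) fun e he => (lt_height_iff hμ).2 he]
  congr 1
  refine filter_congr fun q _ => ?_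
  rw [canonicalTableau_eq_iff hμ]
  refine ⟨fun h => ⟨(lt_height_iff hμ).1 (by omega), h⟩, fun h => h.2⟩

theorem canonicalTableau_mem (hμ : Antitone μ) :
    canonicalTableau μ ∈ reverseBarredTableaux μ 0 := by
  rw [reverseBarredTableaux, mem_filter]
  refine ⟨mem_univ _, fun p q hr hc => ?_, fun p q hc hr => ?_⟩
  · rw [Fin.le_def]
    simp only [canonicalTableau, hr]
    have := height_antitone μ hc.le
    omega
  · have h := q.row_lt_height hμ
    rw [Fin.lt_def] at *
    simp only [canonicalTableau, hc]
    omega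

/-- Each `j` has an `i` directly above it, which is read earlier; this gives an injection. -/
theorem isYamanouchi_canonicalTableau (hμ : Antitone μ) :
    IsYamanouchi (starWord 0 (canonicalTableau μ)) := by
  refine isYamanouchi_starWord_zero fun a i j hij ha => ?_
  have hex : ∀ q : Box μ 0, canonicalTableau μ q = (j, false) →
      ∃ p : Box μ 0, p.col = q.col ∧ (p.row : ℕ) = q.row + 1 := by
    intro q hq
    rw [canonicalTableau_eq_iff hμ] at hq
    have := height_le μ q.col
    let r : Fin d := ⟨q.row + 1, by omega⟩
    exact ⟨boxOf (r := r) (c := q.col) ((lt_height_iff hμ).1 (by simp only [r]; omega)), rfl, rfl⟩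
  choose! f hf using hex
  refine card_le_card_of_injOn f ?_ ?_
  · intro q hq
    simp only [mem_coe, mem_filter, mem_univ, true_and] at hq ⊢
    obtain ⟨h1, h2⟩ := hf q hq.2
    refine ⟨?_, ?_⟩
    · rw [Box.Before, h1, Fin.lt_def, h2]
      rcases hq.1 with h | rfl
      · rw [Box.Before, Fin.lt_def] at h
        omega
      · exact Or.inr ⟨rfl, Nat.lt_succ_self _⟩
    · have := hq.2
      rw [canonicalTableau_eq_iff hμ] at this ⊢
      rw [h1, h2]; omega
  · intro p hp q hq hpq
    simp only [mem_coe, mem_filter, mem_univ, true_and] at hp hq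
    obtain ⟨h1, h2⟩ := hf p hp.2
    obtain ⟨h3, h4⟩ := hf q hq.2
    rw [hpq] at h1 h2
    exact Box.ext' (Fin.ext (by omega)) (by omega)

theorem coeffStar_canonicalTableau : coeffStar 0 (canonicalTableau μ) = 1 := by
  rw [coeffStar, filter_false_of_mem, prod_empty]
  intro a _
  simp [canonicalTableau]

/-- The only Yamanouchi tableau with non-zero coefficient is the canonical one. -/
theorem eq_canonicalTableau (hμ : Antitone μ) {B : Box μ 0 → Fin d × Bool}
    (hB : B ∈ reverseBarredTableaux μ 0) (hY : IsYamanouchi (starWord 0 B))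
    (hc : coeffStar 0 B ≠ 0) : B = canonicalTableau μ := by
  rw [reverseBarredTableaux, mem_filter] at hB
  obtain ⟨-, hrow, hcol⟩ := hB
  beta_reduce at hrow hcol
  -- For `λ = 0` the factor of a barred entry vanishes as soon as the number of earlier unbarred
  -- copies of its letter equals `c(a) - r(a)`.
  have hbar : ∀ a : Box μ 0, (B a).2 = true →
      ((univ.filter fun q => q.Before a ∧ B q = ((B a).1, false)).card : ℤ) ≠
        (a.col : ℤ) - (a.row : ℕ) := by
    intro a ha h
    refine (prod_ne_zero_iff.1 hc) a (mem_filter.2 ⟨mem_univ a, ha⟩) ?_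
    rw [content_starWordBefore, Pi.zero_apply, zero_add, h, shiftIndex, add_sub_assoc, sub_self]
  suffices h : ∀ c, ∀ b : Box μ 0, b.col = c → B b = canonicalTableau μ b from
    funext fun b => h _ b rfl
  intro c
  induction c using Nat.strong_induction_on with
  | _ c ih =>
  intro b hb
  have hd : 0 < d := Nat.lt_of_le_of_lt (Nat.zero_le _) b.row.2
  have hin : ∀ {r : Fin d}, ∀ q : Box μ 0, q.col = c → r ≤ q.row → c < μ r := fun q hq hr =>
    hq ▸ (mem_boxes.1 q.2).2.trans_le (hμ hr)
  -- The bottom box of column `c` holds its largest letter `k`. The earlier columns are canonical by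
  -- induction, and comparison along the bottom row shows that each contains every letter up to `k`
  -- exactly once.
  let b0 : Box μ 0 := boxOf (hin (r := ⟨0, hd⟩) b hb (Nat.zero_le _))
  have hb0c : b0.col = c := rfl
  have hb0r : (b0.row : ℕ) = 0 := rfl
  set k := (B b0).1 with hk
  have hheight : ∀ e < c, (k : ℕ) < height μ e := by
    intro e he
    let p : Box μ 0 := boxOf (r := ⟨0, hd⟩) (c := e) (he.trans (mem_boxes.1 b0.2).2)
    have h := hrow p b0 rfl he
    rw [ih e he p rfl, ← hk, Fin.le_def] at h
    have h0 : 0 < height μ e := (Nat.zero_le _).trans_lt (p.row_lt_height hμ)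
    change (k : ℕ) ≤ height μ e - 1 - 0 at h
    omega
  have hcount : ∀ t : Fin d, t ≤ k →
      (univ.filter fun q : Box μ 0 => q.col < c ∧ B q = (t, false)).card = c := by
    intro t ht
    refine Eq.trans (congrArg card ?_) (card_canonicalTableau hμ (c := c) (t := t) fun e he =>
      lt_of_le_of_lt (Fin.le_def.1 ht) (hheight e he))
    refine filter_congr fun q _ => and_congr_right fun hq => ?_
    rw [ih _ hq q rfl]
  -- If `b0` were barred, exactly `c` unbarred copies of `k` would precede it, and `c(b0) - r(b0) =
  -- c`: its factor would be zero.
  have hb0 : B b0 = (k, false) := by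
    refine Prod.ext rfl ?_
    rw [← Bool.not_eq_true]
    intro htrue
    refine hbar b0 htrue ?_
    have : (univ.filter fun q : Box μ 0 => q.Before b0 ∧ B q = ((B b0).1, false)) =
        univ.filter fun q : Box μ 0 => q.col < c ∧ B q = (k, false) := by
      refine filter_congr fun q _ => ?_
      constructor
      · rintro ⟨h | ⟨h, h'⟩, hq⟩
        · exact ⟨h, hq⟩
        · have hlt := hcol b0 q h.symm h'
          rw [hq] at hlt
          exact absurd hlt (lt_irrefl _)
      · rintro ⟨h, hq⟩
        exact ⟨Or.inl h, hq⟩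
    rw [this, hcount k le_rfl, hb0c, hb0r]; simp
  -- Going up from `b0`: an unbarred `s > 0` in column `c` is at least the `(c + 1)`-st, so an
  -- unbarred `s - 1` must have been read, and only `c` of these are in earlier columns. One
  -- therefore stands above in the same column, and strictness puts it in the next row.
  have hchain : ∀ r : ℕ, r ≤ k → ∃ p : Box μ 0, p.col = c ∧ (p.row : ℕ) = r ∧
      (B p).2 = false ∧ ((B p).1 : ℕ) = k - r := by
    intro r
    induction r with
    | zero => exact fun _ => ⟨b0, rfl, rfl, by rw [hb0], rfl⟩
    | succ r ihr =>
      intro hr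
      obtain ⟨p, hpc, hpr, hp2, hp1⟩ := ihr (by omega)
      let s : Fin d := (B p).1
      have hs : (s : ℕ) = k - r := hp1
      have hps : B p = (s, false) := Prod.ext rfl hp2
      let t : Fin d := ⟨s - 1, by have := s.2; omega⟩
      have ht : (t : ℕ) = s - 1 := rfl
      have hle := hY.card_le p (i := t) (j := s) (by omega)
      have h1 : c + 1 ≤ (univ.filter fun q => (q.Before p ∨ q = p) ∧ B q = (s, false)).card := by
        rw [← hcount s (by rw [Fin.le_def]; omega), ← card_insert_of_notMem (a := p) (by simp [hpc])]
        refine card_le_card fun q hq => ?_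
        simp only [mem_insert, mem_filter, mem_univ, true_and] at hq ⊢
        rcases hq with rfl | ⟨hq, hq'⟩
        · exact ⟨Or.inr rfl, hps⟩
        · exact ⟨Or.inl (Or.inl (by omega)), hq'⟩
      have h2 : ∃ q, ((q.Before p ∨ q = p) ∧ B q = (t, false)) ∧ ¬ q.col < c := by
        by_contra hcon
        push Not at hcon
        have h3 := hcount t (by rw [Fin.le_def]; omega)
        have h4 := card_le_card (show (univ.filter fun q => (q.Before p ∨ q = p) ∧
            B q = (t, false)) ⊆ univ.filter fun q : Box μ 0 => q.col < c ∧ B q = (t, false) by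
          intro q hq
          rw [mem_filter] at hq ⊢
          exact ⟨hq.1, hcon q hq.2, hq.2.2⟩)
        omega
      obtain ⟨q, ⟨hqp, hqt⟩, hqc⟩ := h2
      have hqp' : q.col = c ∧ p.row < q.row := by
        rcases hqp with (h | h) | rfl
        · omega
        · exact ⟨by omega, h.2⟩
        · rw [hps, Prod.mk.injEq, Fin.ext_iff] at hqt; omega
      have hlt : (r : ℕ) + 1 ≤ q.row := by have := Fin.lt_def.1 hqp'.2; omega
      let r' : Fin d := ⟨r + 1, by have := q.row.2; omega⟩
      let p' : Box μ 0 := boxOf (hin (r := r') q hqp'.1 hlt)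
      have hpp' := hcol p p' hpc (Fin.lt_def.2 (show (p.row : ℕ) < r + 1 by omega))
      rcases (show r' ≤ q.row from hlt).lt_or_eq with h | h
      · have hqq := hcol p' q hqp'.1.symm h
        rw [hqt] at hqq
        rw [hps] at hpp'
        rw [Fin.lt_def] at hqq hpp'
        change (t : ℕ) < (B p').1 at hqq
        change ((B p').1 : ℕ) < s at hpp'
        omega
      · exact ⟨q, hqp'.1, by rw [← h], by rw [hqt], by rw [hqt]; change (t : ℕ) = _; omega⟩
  -- The chain ends at row `k` with the smallest letter, so strictness leaves no room for a box
  -- above it.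
  have hk1 : height μ c = k + 1 := by
    obtain ⟨p, hpc, hpr, -, hp1⟩ := hchain k le_rfl
    have h1 := p.row_lt_height hμ
    rw [hpc, hpr] at h1
    by_contra hne
    have hdh := height_le μ c
    let r' : Fin d := ⟨k + 1, by omega⟩
    have hr' : c < μ r' := (lt_height_iff hμ).1 (show (k : ℕ) + 1 < _ by omega)
    have := hcol p (boxOf hr') hpc (Fin.lt_def.2 (show (p.row : ℕ) < k + 1 by omega))
    rw [Fin.lt_def] at this
    omega
  have hbr := b.row_lt_height hμ
  rw [hb, hk1] at hbr
  obtain ⟨p, hpc, hpr, hp2, hp1⟩ := hchain b.row (by omega)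
  have hpb : p = b := Box.ext' (Fin.ext hpr) (hpc.trans hb.symm)
  subst hpb
  rw [show B p = ((B p).1, false) from Prod.ext rfl hp2, eq_comm, canonicalTableau_eq_iff hμ, hpc]
  omega

/-- The bialternant formula. -/
theorem alternant_staircase_mul_factorialSchur (hμ : Antitone μ) :
    alternant (staircase d) 1 * factorialSchur μ = alternant (μ + staircase d) 1 := by
  have h := alternant_mul_factorialSkewSchur (lam := (0 : Fin d → ℕ)) (κ := 0)
    (fun _ _ _ => le_rfl) hμ (fun _ _ _ => le_rfl)
  rw [zero_add] at h
  rw [factorialSchur, h, sum_eq_single (canonicalTableau μ)]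
  · rw [coeffStar_canonicalTableau, map_one, one_mul, content_canonicalTableau hμ, zero_add]
  · intro B hB hne
    rw [mem_filter] at hB
    have h0 : coeffStar 0 B = 0 := by
      by_contra hc
      exact hne (eq_canonicalTableau hμ hB.1 hB.2 hc)
    rw [h0, map_zero, zero_mul]
  · intro hn
    exact absurd (mem_filter.2 ⟨canonicalTableau_mem hμ, isYamanouchi_canonicalTableau hμ⟩) hn

/-- The content of a Yamanouchi word is a partition, so the bialternant formula applies to every
term of the expansion. -/
theorem antitone_add_content {lam κ : Fin d → ℕ} {B : Box μ κ → Fin d × Bool}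
    (hB : IsYamanouchi (starWord lam B)) : Antitone (lam + content (unbarredWord B)) := by
  have h : lam + content (unbarredWord B) = content (starWord lam B) := by
    rw [starWord, content_append, content_youngWord]
  rw [h]
  rcases d with _ | n
  · exact fun i => i.elim0
  · refine Fin.antitone_iff_succ_le.2 fun i => ?_
    exact isYamanouchi_iff.1 hB _ List.prefix_rfl _ _ (by simp)

/-- After multiplication by the nonzero `alternant (staircase d) 1`, the bialternant formula turns
both sides into the alternant expansion. -/
theorem factorialSchur_mul_factorialSkewSchur {lam κ : Fin d → ℕ} (hlam : Antitone lam)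
    (hμ : Antitone μ) (hκ : Antitone κ) :
    factorialSchur lam * factorialSkewSchur μ κ =
      ∑ B ∈ reverseBarredTableaux μ κ with IsYamanouchi (starWord lam B),
        C (coeffStar lam B) * factorialSchur (lam + content (unbarredWord B)) := by
  refine mul_left_cancel₀ alternant_staircase_ne_zero ?_
  rw [← mul_assoc, alternant_staircase_mul_factorialSchur hlam,
    alternant_mul_factorialSkewSchur hlam hμ hκ, mul_sum]
  refine sum_congr rfl fun B hB => ?_
  rw [mem_filter] at hB
  rw [mul_left_comm, alternant_staircase_mul_factorialSchur (antitone_add_content hB.2)]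

end Canonical
end FactorialLR

theorem corollary5p5 (d : ℕ) (lam μ : Fin d → ℕ) (hlam : Antitone lam) (hμ : Antitone μ) :
    (FactorialLR.factorialSchur lam * FactorialLR.factorialSchur μ =
      ∑ B ∈ FactorialLR.reverseBarredTableaux μ 0 with
          FactorialLR.IsYamanouchi (FactorialLR.starWord lam B),
        MvPolynomial.C (FactorialLR.coeffStar lam B) *
          FactorialLR.factorialSchur (lam + FactorialLR.content (FactorialLR.unbarredWord B))) ∧
    (∀ κ : Fin d → ℕ, Antitone κ → κ ≤ μ →
      FactorialLR.factorialSchur lam * FactorialLR.factorialSkewSchur μ κ =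
        ∑ B ∈ FactorialLR.reverseBarredTableaux μ κ with
            FactorialLR.IsYamanouchi (FactorialLR.starWord lam B),
          MvPolynomial.C (FactorialLR.coeffStar lam B) *
            FactorialLR.factorialSchur
              (lam + FactorialLR.content (FactorialLR.unbarredWord B))) :=
  ⟨FactorialLR.factorialSchur_mul_factorialSkewSchur hlam hμ fun _ _ _ => le_rfl,
    fun _ hκ _ => FactorialLR.factorialSchur_mul_factorialSkewSchur hlam hμ hκ⟩
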